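/- For a permutation $\sigma$ of $\{1,\dots,n\}$ let $\mathrm{Des}(\sigma)=\{i\in\{1,\dots,n-1\}:\sigma(i)>\sigma(i+1)\}$, $\mathrm{des}(\sigma)=|\mathrm{Des}(\sigma)|$, $\mathrm{maj}(\sigma)=\sum_{i\in \mathrm{Des}(\sigma)} i$, $\mathrm{exc}(\sigma)=|\{i:\sigma(i)>i\}|$ and $\mathrm{fix}(\sigma)=|\{i:\sigma(i)=i\}|$. For integers $n,k\ge 0$ let $$A_{n}^{\mathrm{maj},\mathrm{des},\mathrm{exc}}(q,p,t)=\sum_{\sigma\in\mathfrak S_n}q^{\mathrm{maj}(\sigma)}p^{\mathrm{des}(\sigma)}t^{\mathrm{exc}(\sigma)},\qquad A_{n,k}^{\mathrm{maj},\mathrm{des},\mathrm{exc}}(q,p,t)=\sum_{\sigma\in\mathfrak S_n,\ \mathrm{fix}(\sigma)=k}q^{\mathrm{maj}(\sigma)}p^{\mathrm{des}(\sigma)}t^{\mathrm{exc}(\sigma)}.$$ Order $\mathbb Q[q,p]$ by: $f\le g$ if $g-f$ has nonnegative coefficients. A nonzero polynomial $f(t)=f_rt^r+\dots+f_st^s$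 over $\mathbb Q[q,p]$ with $f_r\ne 0\ne f_s$ is called $t$-symmetric with center of symmetry $\frac{s+r}{2}$ if $f_{r+i}=f_{s-i}$ for $0\le i\le s-r$, and it is also $t$-unimodal if $f_r\le f_{r+1}\le\dots\le f_{\lfloor (s+r)/2\rfloor}=f_{\lfloor (s+r+1)/2\rfloor}\ge\dots\ge f_{s-1}\ge f_s$. **Theorem.** The polynomials in $t$ listed below have coefficients in $\mathbb Q[q,p]$, are nonzero, and satisfy: 1. for all $n,k\ge 0$ with $k\le n$ and $k\ne n-1$, $A_{n,k}^{\mathrm{maj},\mathrm{des},\mathrm{exc}}(q,p,q^{-1}t)$ is $t$-symmetric with center of symmetry $\frac{n-k}{2}$; 2. for all $n\ge 0$ with $n\ne 1$, $A_{n,0}^{\mathrm{maj},\mathrm{des},\mathrm{exc}}(q,p,q^{-1}t)$ is $t$-symmetric and $t$-unimodal, with center of symmetry $\frac n2$; 3. for all $n,k\ge 0$ with $k\le n$ and $k\ne n-1$, $A_{n,k}^{\mathrm{maj},\mathrm{des},\mathrm{exc}}(q,1,q^{-1}t)$ is $t$-symmetric and $t$-unimodal, with center of symmetry $\frac{n-k}{2}$;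 4. for all $n\ge 1$, $A_{n}^{\mathrm{maj},\mathrm{des},\mathrm{exc}}(q,1,q^{-1}t)$ is $t$-symmetric and $t$-unimodal, with center of symmetry $\frac{n-1}{2}$. (If $k>n$ or $k=n-1$, no permutation of $\{1,\dots,n\}$ has exactly $k$ fixed points, and $A_{n,k}^{\mathrm{maj},\mathrm{des},\mathrm{exc}}=0$.) -/

import Mathlib

open Polynomial

section Statistics

variable {n : ℕ}

/-- The descent set of `σ`. The element `i : Fin n` stands for the position `i + 1`
of `{1, ..., n}`. -/
def descentSet (σ : Equiv.Perm (Fin n)) : Finset (Fin n) :=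
  Finset.univ.filter fun i => ∃ h : (i : ℕ) + 1 < n, σ ⟨(i : ℕ) + 1, h⟩ < σ i

/-- The descent number. -/
def desNumber (σ : Equiv.Perm (Fin n)) : ℕ := (descentSet σ).card

/-- The major index: the sum of the descents, as positions in `{1, ..., n - 1}`. -/
def majIndex (σ : Equiv.Perm (Fin n)) : ℕ := ∑ i ∈ descentSet σ, ((i : ℕ) + 1)

/-- The excedance number. -/
def excNumber (σ : Equiv.Perm (Fin n)) : ℕ :=
  (Finset.univ.filter fun i : Fin n => i < σ i).card

/-- The number of fixed points. -/
def fixNumber (σ : Equiv.Perm (Fin n)) : ℕ :=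
  (Finset.univ.filter fun i : Fin n => σ i = i).card

end Statistics

section EulerianPolynomials

variable {S : Type*} [CommSemiring S]

/-- The polynomial `A_n^{maj,des,exc}(q,p,t)`, with values substituted for its variables. -/
def eulerianA (n : ℕ) (q p t : S) : S :=
  ∑ σ : Equiv.Perm (Fin n), q ^ majIndex σ * p ^ desNumber σ * t ^ excNumber σ

/-- The polynomial `A_{n,k}^{maj,des,exc}(q,p,t)`, the sum over the permutations with exactly
`k` fixed points, with values substituted for its variables. -/
def eulerianAFix (n k : ℕ) (q p t : S) : S :=
  ∑ σ : Equiv.Perm (Fin n) with fixNumber σ = k,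
    q ^ majIndex σ * p ^ desNumber σ * t ^ excNumber σ

end EulerianPolynomials

section SymmetryUnimodality

variable {R : Type*} [Semiring R]

/-- `f = f_r t^r + ... + f_s t^s` (nonzero, `r` its lowest and `s` its highest exponent) is
`t`-symmetric with center of symmetry `c = (s + r) / 2`. -/
def IsTSymmetric (f : R[X]) (c : ℚ) : Prop :=
  f ≠ 0 ∧ ((f.natDegree : ℚ) + (f.natTrailingDegree : ℚ)) / 2 = c ∧
    ∀ i ≤ f.natDegree - f.natTrailingDegree,
      f.coeff (f.natTrailingDegree + i) = f.coeff (f.natDegree - i)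

/-- `f = f_r t^r + ... + f_s t^s` is `t`-unimodal for the order relation `le` on coefficients:
`f_r ≤ ... ≤ f_⌊(s+r)/2⌋ = f_⌊(s+r+1)/2⌋ ≥ ... ≥ f_s`. -/
def IsTUnimodal (le : R → R → Prop) (f : R[X]) : Prop :=
  (∀ i, f.natTrailingDegree ≤ i → i < (f.natDegree + f.natTrailingDegree) / 2 →
      le (f.coeff i) (f.coeff (i + 1))) ∧
  f.coeff ((f.natDegree + f.natTrailingDegree) / 2) =
    f.coeff ((f.natDegree + f.natTrailingDegree + 1) / 2) ∧
  (∀ i, (f.natDegree + f.natTrailingDegree + 1) / 2 ≤ i → i < f.natDegree →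
      le (f.coeff (i + 1)) (f.coeff i))

end SymmetryUnimodality

noncomputable section CoefficientRing

/-- The ring `ℚ[q,p]`; variable `0` is `q` and variable `1` is `p`. -/
abbrev QP : Type := MvPolynomial (Fin 2) ℚ

/-- The field `ℚ(q,p)`, in which `q⁻¹` lives. -/
abbrev QPField : Type := FractionRing QP

/-- The indeterminate `q` in `ℚ(q,p)`. -/
def qVar : QPField := algebraMap QP QPField (MvPolynomial.X 0)

/-- The indeterminate `p` in `ℚ(q,p)`. -/
def pVar : QPField := algebraMap QP QPField (MvPolynomial.X 1)

/-- The coefficientwise order on `ℚ[q,p]`: `g - f` has nonnegative coefficients. -/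
def CoeffLE (f g : QP) : Prop := ∀ m : Fin 2 →₀ ℕ, 0 ≤ (g - f).coeff m

/-- `F ∈ ℚ[q,p][t]` is equal to `G ∈ ℚ(q,p)[t]`. -/
def RepresentsOverQP (F : QP[X]) (G : QPField[X]) : Prop :=
  F.map (algebraMap QP QPField) = G

end CoefficientRing

/-! ### Diagonal coefficients as power series. -/

section DiagonalSeries

variable {R : Type*} [CommRing R]

/-! Write h_n(m) = h_n(1, q, ..., q^(m-1)), [i]_t = 1 + ... + t^(i-1), and D(m) for the inverse of 1
- ∑_{i≥2} t [i-1]_t h_i(m) z^i. `sum_perm_eq_coeff` states that ∑_σ t^exc r^fix q^(maj-exc)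
h_n(m+1-des) is the coefficient of z^n in (∑_j r^j h_j(m+1) z^j) D(m).
`sum_perm_eq_coeff_shiftSeq_one` is a companion for n ≥ 1: with r = 1, and with des increased by one
when σ fixes the first point, the series becomes (∑_j h_j(m) z^j) D(m).

Both come from counting pairs (permutation, compatible colouring) in two ways. For fixed σ the
colourings amount to weakly decreasing sequences with prescribed drops, whose number is des and
whose weighted sum is maj - exc (`shift_sums`). Summed over σ, standardization turns the pairs into
words restricted only position by position, and these are evaluated as in MacMahon's master theorem
(`rowSeries_mul_eq`, `diagSeries_rowWords_mul_eq`).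

The coefficient of r^k is h_k(m+1) times the coefficient of z^(n-k) in D(m). By the recursion for D
this is a sum of products h_{i_1}(m) ... h_{i_l}(m) h_k(m+1), each with coefficient ∏ t [i_j - 1]_t,
which is symmetric and unimodal about (n-k)/2. Such a product enumerates concatenations of weakly
decreasing words; a second standardization (`blockWordSum_eq`) writes it as a sum of terms q^a
h_n(m+1-d). Since the sequences m ↦ h_n(m+1-d), 0 ≤ d ≤ n, are independent (`eq_of_sum_mul_hq_eq`),
comparison shows that for each d the permutations with fix = k and des = d have a symmetric unimodal
enumerator. The variable p only records d, which gives the first three claims.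

Summing over k would mix centers, so the fourth claim uses the companion: there h_i + t [i-1]_t h_i
= [i]_t h_i, and all terms have center (n-1)/2. Finally q^maj (t/q)^exc = q^(maj-exc) t^exc is
polynomial because exc ≤ maj. -/

/-- Splitting the exponent vectors of total degree `n + 1` by whether the exponent at `a`
vanishes. -/
theorem sum_finsuppAntidiag_succ {M : Type*} [AddCommMonoid M] {B : Finset ℕ} {a : ℕ}
    (ha : a ∈ B) (n : ℕ) (f : (ℕ →₀ ℕ) → M) :
    ∑ μ ∈ B.finsuppAntidiag (n + 1), f μ =
      ∑ μ ∈ (B.erase a).finsuppAntidiag (n + 1), f μ +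
        ∑ μ ∈ B.finsuppAntidiag n, f (μ + Finsupp.single a 1) := by
  rw [← Finset.sum_filter_add_sum_filter_not _ (fun μ : ℕ →₀ ℕ => μ a = 0)]
  congr 1
  · apply Finset.sum_congr _ (fun _ _ => rfl)
    ext μ
    simp only [Finset.mem_filter, Finset.mem_finsuppAntidiag']
    constructor
    · rintro ⟨⟨h1, h2⟩, h3⟩
      refine ⟨h1, fun x hx => Finset.mem_erase.2 ⟨?_, h2 hx⟩⟩
      rintro rfl
      exact (Finsupp.mem_support_iff.1 hx) h3
    · rintro ⟨h1, h2⟩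
      refine ⟨⟨h1, h2.trans (Finset.erase_subset _ _)⟩, ?_⟩
      by_contra h
      exact (Finset.mem_erase.1 (h2 (Finsupp.mem_support_iff.2 h))).1 rfl
  · symm
    refine Finset.sum_bij (fun μ _ => μ + Finsupp.single a 1) ?_ ?_ ?_ (fun _ _ => rfl)
    · intro μ hμ
      rw [Finset.mem_finsuppAntidiag'] at hμ
      rw [Finset.mem_filter, Finset.mem_finsuppAntidiag']
      refine ⟨⟨?_, ?_⟩, by simp⟩
      · rw [Finsupp.sum_add_index' (fun _ => rfl) (fun _ _ _ => rfl), hμ.1]; simp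
      · refine Finsupp.support_add.trans (Finset.union_subset hμ.2 ?_)
        exact Finsupp.support_single_subset.trans (by simpa using ha)
    · intro μ _ ν _ h
      exact add_right_cancel h
    · intro μ hμ
      rw [Finset.mem_filter, Finset.mem_finsuppAntidiag'] at hμ
      have hle : Finsupp.single a 1 ≤ μ := by
        rw [Finsupp.single_le_iff]; exact Nat.one_le_iff_ne_zero.2 hμ.2
      refine ⟨μ - Finsupp.single a 1, ?_, tsub_add_cancel_of_le hle⟩
      rw [Finset.mem_finsuppAntidiag']
      constructor
      · have := hμ.1.1
        rw [← tsub_add_cancel_of_le hle,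
          Finsupp.sum_add_index' (fun _ => rfl) (fun _ _ _ => rfl)] at this
        simpa using this
      · exact (Finsupp.support_tsub).trans hμ.1.2

/-- The monomial `s ^ μ`. -/
def weightPow (s : ℕ → R) (μ : ℕ →₀ ℕ) : R := μ.prod fun a k => s a ^ k

theorem weightPow_add_single (s : ℕ → R) (μ : ℕ →₀ ℕ) (a : ℕ) :
    weightPow s (μ + Finsupp.single a 1) = s a * weightPow s μ := by
  rw [weightPow, Finsupp.prod_add_index' (fun _ => pow_zero _) (fun _ _ _ => pow_add _ _ _)]
  simp [weightPow, mul_comm]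

/-- The generating function of the diagonal coefficients
`s ^ μ * [x ^ (μ + ν)] g * ∏ b ∈ B, W b (μ b)`, where `z` marks the degree of `μ`. -/
noncomputable def diagSeries (B : Finset ℕ) (s : ℕ → R) (ν : ℕ →₀ ℕ) (g : MvPolynomial ℕ R)
    (W : ℕ → ℕ → MvPolynomial ℕ R) : PowerSeries R :=
  PowerSeries.mk fun n => ∑ μ ∈ B.finsuppAntidiag n,
    weightPow s μ * MvPolynomial.coeff (μ + ν) (g * ∏ b ∈ B, W b (μ b))

theorem diagSeries_sum (B : Finset ℕ) (s : ℕ → R) (ν : ℕ →₀ ℕ) (W : ℕ → ℕ → MvPolynomial ℕ R)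
    {ι : Type*} (T : Finset ι) (c : ι → R) (g : ι → MvPolynomial ℕ R) :
    diagSeries B s ν (∑ i ∈ T, MvPolynomial.C (c i) * g i) W =
      ∑ i ∈ T, PowerSeries.C (c i) * diagSeries B s ν (g i) W := by
  ext n
  simp only [diagSeries, PowerSeries.coeff_mk, map_sum, PowerSeries.coeff_C_mul]
  simp_rw [Finset.mul_sum]
  rw [Finset.sum_comm]
  refine Finset.sum_congr rfl fun μ _ => ?_
  rw [Finset.sum_mul, MvPolynomial.coeff_sum, Finset.mul_sum]
  refine Finset.sum_congr rfl fun i _ => ?_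
  rw [mul_assoc, MvPolynomial.coeff_C_mul]
  ring

/-- Changing `W b (k + 1)` by `- γ x_b W b k` multiplies the diagonal series by `1 - γ s_b z`. -/
theorem diagSeries_update {B : Finset ℕ} {b : ℕ} (hb : b ∈ B) (s : ℕ → R) (γ : R)
    (W W' : ℕ → ℕ → MvPolynomial ℕ R) (hne : ∀ a ∈ B, a ≠ b → W' a = W a)
    (h0 : W' b 0 = W b 0)
    (h1 : ∀ k, W' b (k + 1) = W b (k + 1) - MvPolynomial.C γ * (MvPolynomial.X b * W b k)) :
    diagSeries B s 0 1 W' =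
      (1 - PowerSeries.C (γ * s b) * PowerSeries.X) * diagSeries B s 0 1 W := by
  have key : ∀ μ : ℕ →₀ ℕ, μ b = 0 → ∏ a ∈ B, W' a (μ a) = ∏ a ∈ B, W a (μ a) := by
    intro μ hμ
    refine Finset.prod_congr rfl fun a ha => ?_
    by_cases hab : a = b
    · subst hab; rw [hμ, h0]
    · rw [hne a ha hab]
  ext n
  cases n with
  | zero =>
    rw [sub_mul, one_mul, map_sub, mul_assoc, PowerSeries.coeff_C_mul,
      PowerSeries.coeff_zero_X_mul, mul_zero, sub_zero]
    simp only [diagSeries, PowerSeries.coeff_mk, Finset.finsuppAntidiag_zero,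
      Finset.sum_singleton]
    rw [key 0 rfl]
  | succ n =>
    rw [sub_mul, one_mul, map_sub, mul_assoc, PowerSeries.coeff_C_mul,
      PowerSeries.coeff_succ_X_mul]
    simp only [diagSeries, PowerSeries.coeff_mk]
    rw [sum_finsuppAntidiag_succ hb, sum_finsuppAntidiag_succ hb, add_sub_assoc]
    congr 1
    · refine Finset.sum_congr rfl fun μ hμ => ?_
      rw [key]
      rw [Finset.mem_finsuppAntidiag'] at hμ
      by_contra h
      exact (Finset.mem_erase.1 (hμ.2 (Finsupp.mem_support_iff.2 h))).1 rfl
    · rw [Finset.mul_sum, ← Finset.sum_sub_distrib]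
      refine Finset.sum_congr rfl fun μ _ => ?_
      have hprod : ∏ a ∈ B, W' a ((μ + Finsupp.single b 1 : ℕ →₀ ℕ) a) =
          ∏ a ∈ B, W a ((μ + Finsupp.single b 1 : ℕ →₀ ℕ) a) -
            MvPolynomial.C γ * (MvPolynomial.X b * ∏ a ∈ B, W a (μ a)) := by
        rw [← Finset.mul_prod_erase B _ hb, ← Finset.mul_prod_erase B _ hb,
          ← Finset.mul_prod_erase B _ hb]
        have e1 : ∏ a ∈ B.erase b, W' a ((μ + Finsupp.single b 1 : ℕ →₀ ℕ) a) =
            ∏ a ∈ B.erase b, W a (μ a) := by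
          refine Finset.prod_congr rfl fun a ha => ?_
          have := Finset.mem_erase.1 ha
          rw [hne a this.2 this.1, Finsupp.add_apply,
            Finsupp.single_eq_of_ne this.1, add_zero]
        have e2 : ∏ a ∈ B.erase b, W a ((μ + Finsupp.single b 1 : ℕ →₀ ℕ) a) =
            ∏ a ∈ B.erase b, W a (μ a) := by
          refine Finset.prod_congr rfl fun a ha => ?_
          have := Finset.mem_erase.1 ha
          rw [Finsupp.add_apply, Finsupp.single_eq_of_ne this.1, add_zero]
        rw [e1, e2]
        simp only [Finsupp.add_apply, Finsupp.single_eq_same, h1]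
        ring
      rw [hprod, one_mul, MvPolynomial.coeff_sub, MvPolynomial.coeff_C_mul, add_zero,
        add_comm μ, MvPolynomial.coeff_X_mul, add_comm _ μ, weightPow_add_single]
      simp only [one_mul, add_zero]
      ring

end DiagonalSeries

/-! ### The master theorem for the matrix of row weights. -/

section MasterIdentity

variable {R : Type*} [CommRing R]

/-- A letter `a` in the row of `b` has weight `t` if `a < b` and weight `1` if `a > b`, the
letters in `φ` occurring only in their own rows. -/
def rowWeight (φ : ℕ → Prop) [DecidablePred φ] (t : R) (b a : ℕ) : R :=
  if b = a then (if φ b then 1 else 1 + t)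
  else if φ a ∨ φ b then 0 else if a < b then t else 1

/-- The row of `b` as a linear form in the letters below `N`. -/
noncomputable def rowForm (φ : ℕ → Prop) [DecidablePred φ] (t : R) (N b : ℕ) :
    MvPolynomial ℕ R :=
  ∑ a ∈ Finset.range N, MvPolynomial.C (rowWeight φ t b a) * MvPolynomial.X a

variable (φ : ℕ → Prop) [DecidablePred φ] (t : R) (s : ℕ → R) (N : ℕ)

/-- The series `∑ s ^ μ * [x ^ (μ + ν)] g * ∏ L_b ^ μ_b` over the exponents supported on
`{0, ..., M - 1}`. -/
noncomputable def rowSeries (M : ℕ) (ν : ℕ →₀ ℕ) (g : MvPolynomial ℕ R) : PowerSeries R :=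
  diagSeries (Finset.range M) s ν g fun b k => rowForm φ t N b ^ k

theorem rowSeries_eq_zero {M : ℕ} {ν : ℕ →₀ ℕ} {a : ℕ} (hM : M ≤ a) (hν : ν a = 0) :
    rowSeries φ t s N M ν (MvPolynomial.X a) = 0 := by
  ext n
  simp only [rowSeries, diagSeries, PowerSeries.coeff_mk, map_zero]
  refine Finset.sum_eq_zero fun μ hμ => ?_
  rw [MvPolynomial.coeff_X_mul', if_neg, mul_zero]
  rw [Finset.mem_finsuppAntidiag'] at hμ
  rw [Finsupp.notMem_support_iff, Finsupp.add_apply, hν, add_zero]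
  by_contra h
  have := Finset.mem_range.1 (hμ.2 (Finsupp.mem_support_iff.2 h))
  omega

theorem prod_pow_add_single {M : ℕ} {a : ℕ} (ha : a < M) (L : ℕ → MvPolynomial ℕ R)
    (μ : ℕ →₀ ℕ) :
    ∏ b ∈ Finset.range M, L b ^ ((μ + Finsupp.single a 1 : ℕ →₀ ℕ) b) =
      L a * ∏ b ∈ Finset.range M, L b ^ μ b := by
  simp only [Finsupp.add_apply, pow_add, Finset.prod_mul_distrib]
  rw [mul_comm]
  congr 1
  rw [Finset.prod_eq_single a]
  · simp
  · intro b _ hb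
    rw [Finsupp.single_eq_of_ne hb, pow_zero]
  · intro h
    exact absurd (Finset.mem_range.2 ha) h

/-- Since ν vanishes at a, only exponents with μ a ≥ 1 contribute. Lowering μ a by one cancels x_a
and releases a factor s_a z and a row form of a. Expanding that form gives linear equations between
the series attached to the letters. -/
theorem rowSeries_X {M : ℕ} {ν : ℕ →₀ ℕ} {a : ℕ} (ha : a < M) (hν : ν a = 0) :
    rowSeries φ t s N M ν (MvPolynomial.X a) =
      PowerSeries.C (s a) * (PowerSeries.X * rowSeries φ t s N M ν (rowForm φ t N a)) := by
  ext n
  cases n with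
  | zero =>
    rw [PowerSeries.coeff_C_mul, PowerSeries.coeff_zero_X_mul, mul_zero]
    simp only [rowSeries, diagSeries, PowerSeries.coeff_mk, Finset.finsuppAntidiag_zero,
      Finset.sum_singleton]
    rw [MvPolynomial.coeff_X_mul', if_neg, mul_zero]
    rw [Finsupp.notMem_support_iff, Finsupp.add_apply, hν]
    rfl
  | succ n =>
    rw [PowerSeries.coeff_C_mul, PowerSeries.coeff_succ_X_mul]
    simp only [rowSeries, diagSeries, PowerSeries.coeff_mk]
    rw [sum_finsuppAntidiag_succ (Finset.mem_range.2 ha), Finset.sum_eq_zero, zero_add,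
      Finset.mul_sum]
    · refine Finset.sum_congr rfl fun μ _ => ?_
      rw [prod_pow_add_single ha, weightPow_add_single, mul_assoc,
        show μ + Finsupp.single a 1 + ν = Finsupp.single a 1 + (μ + ν) by abel,
        MvPolynomial.coeff_X_mul]
    · intro μ hμ
      rw [MvPolynomial.coeff_X_mul', if_neg, mul_zero]
      rw [Finset.mem_finsuppAntidiag'] at hμ
      rw [Finsupp.notMem_support_iff, Finsupp.add_apply, hν, add_zero]
      by_contra h
      exact (Finset.mem_erase.1 (hμ.2 (Finsupp.mem_support_iff.2 h))).1 rfl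

theorem rowSeries_single {M b : ℕ} :
    rowSeries φ t s N M (Finsupp.single b 1) (MvPolynomial.X b) = rowSeries φ t s N M 0 1 := by
  ext n
  simp only [rowSeries, diagSeries, PowerSeries.coeff_mk]
  refine Finset.sum_congr rfl fun μ _ => ?_
  rw [add_comm μ, MvPolynomial.coeff_X_mul, add_zero, one_mul]

/-- The exponents with μ M = 0 give the old series. From each of the others one factor of row M is
split off, and the shift ν = e_M compensates for the lowered exponent. -/
theorem rowSeries_succ (M : ℕ) :
    rowSeries φ t s N (M + 1) 0 1 = rowSeries φ t s N M 0 1 +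
      PowerSeries.C (s M) * (PowerSeries.X *
        rowSeries φ t s N (M + 1) (Finsupp.single M 1) (rowForm φ t N M)) := by
  have her : (Finset.range (M + 1)).erase M = Finset.range M := by
    ext x; simp only [Finset.mem_erase, Finset.mem_range]; omega
  have key : ∀ n, ∀ μ ∈ (Finset.range M).finsuppAntidiag n,
      ∏ b ∈ Finset.range (M + 1), rowForm φ t N b ^ μ b =
        ∏ b ∈ Finset.range M, rowForm φ t N b ^ μ b := by
    intro n μ hμ
    rw [Finset.mem_finsuppAntidiag'] at hμ
    have : μ M = 0 := by
      by_contra h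
      have := Finset.mem_range.1 (hμ.2 (Finsupp.mem_support_iff.2 h))
      omega
    rw [Finset.prod_range_succ, this, pow_zero, mul_one]
  ext n
  cases n with
  | zero =>
    rw [map_add, PowerSeries.coeff_C_mul, PowerSeries.coeff_zero_X_mul, mul_zero, add_zero]
    simp only [rowSeries, diagSeries, PowerSeries.coeff_mk, Finset.finsuppAntidiag_zero,
      Finset.sum_singleton, Finsupp.coe_zero, Pi.zero_apply, pow_zero, Finset.prod_const_one]
  | succ n =>
    rw [map_add, PowerSeries.coeff_C_mul, PowerSeries.coeff_succ_X_mul]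
    simp only [rowSeries, diagSeries, PowerSeries.coeff_mk]
    rw [sum_finsuppAntidiag_succ (Finset.self_mem_range_succ M), her]
    congr 1
    · exact Finset.sum_congr rfl fun μ hμ => by rw [key _ μ hμ]
    · rw [Finset.mul_sum]
      refine Finset.sum_congr rfl fun μ _ => ?_
      rw [prod_pow_add_single (Nat.lt_succ_self M), weightPow_add_single, mul_assoc, one_mul,
        add_zero]

theorem rowSeries_rowForm (M : ℕ) (ν : ℕ →₀ ℕ) (b : ℕ) :
    rowSeries φ t s N M ν (rowForm φ t N b) = ∑ a ∈ Finset.range N,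
      PowerSeries.C (rowWeight φ t b a) * rowSeries φ t s N M ν (MvPolynomial.X a) :=
  diagSeries_sum _ _ _ _ _ _ _

theorem sum_rowWeight_of_mem {S : Type*} [CommRing S] (c : R →+* S) (f : ℕ → S) {b : ℕ}
    (hb : b < N) (hφ : φ b) :
    ∑ a ∈ Finset.range N, c (rowWeight φ t b a) * f a = f b := by
  rw [Finset.sum_eq_single b]
  · simp [rowWeight, hφ]
  · intro a _ ha
    simp [rowWeight, hφ, Ne.symm ha]
  · intro h
    exact absurd (Finset.mem_range.2 hb) h

/-- Outside φ a row of weights is the all-ones row, corrected by t - 1 left of the diagonal and by t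
on it. Only the total and a partial sum of f enter, so the system can be solved by telescoping. -/
theorem sum_rowWeight_of_notMem {S : Type*} [CommRing S] (c : R →+* S) (f : ℕ → S) {b : ℕ}
    (hb : b < N) (hφ : ¬ φ b) (hf : ∀ a < N, φ a → f a = 0) :
    ∑ a ∈ Finset.range N, c (rowWeight φ t b a) * f a =
      ∑ a ∈ Finset.range N, f a - (1 - c t) * ∑ a ∈ Finset.range b, f a + c t * f b := by
  have h1 : ∀ a ∈ Finset.range N, c (rowWeight φ t b a) * f a =
      f a + (if a < b then (c t - 1) * f a else 0) + (if b = a then c t * f a else 0) := by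
    intro a ha
    by_cases hφa : φ a
    · simp [hf a (Finset.mem_range.1 ha) hφa]
    · rcases lt_trichotomy a b with h | h | h
      · simp [rowWeight, hφ, hφa, h, h.ne']
        ring
      · subst h
        simp [rowWeight, hφ]
        ring
      · simp [rowWeight, hφ, hφa, h.ne, h.not_gt]
  rw [Finset.sum_congr rfl h1, Finset.sum_add_distrib, Finset.sum_add_distrib,
    Finset.sum_ite_eq, if_pos (Finset.mem_range.2 hb), ← Finset.sum_filter, ← Finset.mul_sum]
  have : (Finset.range N).filter (· < b) = Finset.range b := by
    ext x; simp only [Finset.mem_filter, Finset.mem_range]; omega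
  rw [this]
  ring

/-- The factor `1 - c s_b z`. -/
noncomputable def linFactor (c : R) (b : ℕ) : PowerSeries R :=
  1 - PowerSeries.C (c * s b) * PowerSeries.X

theorem isUnit_linFactor (c : R) (b : ℕ) : IsUnit (linFactor s c b) := by
  rw [PowerSeries.isUnit_iff_constantCoeff]
  simp [linFactor]

/-- The product of `1 - c s_b z` over the letters below `M` in the set `ψ`. -/
noncomputable def linProd (ψ : ℕ → Prop) [DecidablePred ψ] (c : R) (M : ℕ) : PowerSeries R :=
  ∏ b ∈ (Finset.range M).filter ψ, linFactor s c b

theorem linProd_succ_of_pos {ψ : ℕ → Prop} [DecidablePred ψ] {c : R} {M : ℕ} (h : ψ M) :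
    linProd s ψ c (M + 1) = linProd s ψ c M * linFactor s c M := by
  rw [linProd, Finset.range_add_one, Finset.filter_insert, if_pos h, Finset.prod_insert
    (by simp), mul_comm, linProd]

theorem linProd_succ_of_neg {ψ : ℕ → Prop} [DecidablePred ψ] {c : R} {M : ℕ} (h : ¬ ψ M) :
    linProd s ψ c (M + 1) = linProd s ψ c M := by
  rw [linProd, Finset.range_add_one, Finset.filter_insert, if_neg h, linProd]

theorem rowSeries_zero : rowSeries φ t s N 0 0 1 = 1 := by
  ext n
  simp only [rowSeries, diagSeries, PowerSeries.coeff_mk, Finset.range_zero, PowerSeries.coeff_one]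
  cases n with
  | zero => simp [weightPow]
  | succ n => simp

/-- The determinant evaluation in the master theorem for the matrix `rowWeight`. -/
theorem rowSeries_mul_eq {M : ℕ} (hM : M ≤ N) :
    rowSeries φ t s N M 0 1 * linProd s φ 1 M *
      (linProd s (fun a => ¬ φ a) 1 M - PowerSeries.C t * linProd s (fun a => ¬ φ a) t M) =
        1 - PowerSeries.C t := by
  induction M with
  | zero => simp [rowSeries_zero, linProd]
  | succ b ih =>
    have hb : b < N := hM
    specialize ih hb.le
    -- These are the unknowns of a linear system: the equations for a < b are homogeneous, f b is
    -- the new series, and f vanishes beyond b. The equation for b brings in the old series. Solving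
    -- the system replaces the expansion of a determinant.
    set f : ℕ → PowerSeries R := fun a =>
      rowSeries φ t s N (b + 1) (Finsupp.single b 1) (MvPolynomial.X a) with hf
    have hfb : f b = rowSeries φ t s N (b + 1) 0 1 := rowSeries_single φ t s N
    have hf0 : ∀ a, b < a → f a = 0 := fun a ha =>
      rowSeries_eq_zero φ t s N ha (Finsupp.single_eq_of_ne ha.ne')
    have hfa : ∀ a, a < b → f a = PowerSeries.C (s a) * (PowerSeries.X *
        ∑ a' ∈ Finset.range N, PowerSeries.C (rowWeight φ t a a') * f a') := by
      intro a ha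
      rw [hf]
      simp only
      rw [rowSeries_X φ t s N (by omega) (Finsupp.single_eq_of_ne ha.ne), rowSeries_rowForm]
    have hsucc := rowSeries_succ φ t s N b
    rw [rowSeries_rowForm] at hsucc
    change _ = _ + PowerSeries.C (s b) * (PowerSeries.X *
      ∑ a' ∈ Finset.range N, PowerSeries.C (rowWeight φ t b a') * f a') at hsucc
    set Φ := rowSeries φ t s N (b + 1) 0 1
    set Φ' := rowSeries φ t s N b 0 1
    by_cases hφ : φ b
    · rw [sum_rowWeight_of_mem φ t N PowerSeries.C f hb hφ, hfb] at hsucc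
      rw [linProd_succ_of_pos s hφ, linProd_succ_of_neg s (not_not.2 hφ),
        linProd_succ_of_neg s (not_not.2 hφ), ← ih]
      have : Φ * linFactor s 1 b = Φ' := by
        rw [linFactor, one_mul]
        linear_combination hsucc
      rw [← this]
      ring
    -- The equation of a letter a of φ below b reads f a = s_a z f a, which forces f a = 0.
    · have hφ0 : ∀ a < N, φ a → f a = 0 := by
        intro a ha hφa
        rcases lt_trichotomy a b with h | h | h
        · have h2 := hfa a h
          rw [sum_rowWeight_of_mem φ t N PowerSeries.C f ha hφa] at h2
          refine (isUnit_linFactor s 1 a).mul_left_eq_zero.1 ?_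
          rw [linFactor, one_mul]
          linear_combination h2
        · exact absurd (h ▸ hφa) hφ
        · exact hf0 a h
      set F := ∑ a ∈ Finset.range N, f a with hF
      have hFb : F = ∑ a ∈ Finset.range b, f a + Φ := by
        rw [hF, ← hfb, ← Finset.sum_range_succ]
        symm
        refine Finset.sum_subset (Finset.range_subset_range.2 hM) fun a _ ha => hf0 a ?_
        rw [Finset.mem_range] at ha
        omega
      -- With U_a = F - (1 - t) ∑_{a' < a} f a', the equation for a outside φ reads (1 - t s_a z) f
      -- a = s_a z U_a. Hence (1 - t s_a z) U_{a+1} = (1 - s_a z) U_a, and the products build up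
      -- factor by factor.
      have hU : ∀ a ≤ b, (F - (1 - PowerSeries.C t) * ∑ a' ∈ Finset.range a, f a') *
          linProd s (fun a => ¬ φ a) t a = F * linProd s (fun a => ¬ φ a) 1 a := by
        intro a ha
        induction a with
        | zero => simp [linProd]
        | succ a iha =>
          specialize iha (by omega)
          rw [Finset.sum_range_succ]
          by_cases hφa : φ a
          · rw [linProd_succ_of_neg s (not_not.2 hφa), linProd_succ_of_neg s (not_not.2 hφa),
              hφ0 a (by omega) hφa, add_zero, iha]
          · rw [linProd_succ_of_pos (ψ := fun a => ¬ φ a) s hφa,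
              linProd_succ_of_pos (ψ := fun a => ¬ φ a) s hφa]
            have h2 := hfa a (by omega)
            rw [sum_rowWeight_of_notMem φ t N PowerSeries.C f (by omega) hφa hφ0, ← hF] at h2
            rw [linFactor, linFactor, map_mul, map_mul, map_one]
            linear_combination
              (1 - PowerSeries.C (s a) * PowerSeries.X) * iha +
              (-(1 - PowerSeries.C t) * linProd s (fun a => ¬ φ a) t a) * h2
      have hUb := hU b le_rfl
      rw [sum_rowWeight_of_notMem φ t N PowerSeries.C f hb hφ hφ0, ← hF, hfb] at hsucc
      rw [linProd_succ_of_neg s hφ, linProd_succ_of_pos (ψ := fun a => ¬ φ a) s hφ,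
        linProd_succ_of_pos (ψ := fun a => ¬ φ a) s hφ, linFactor, linFactor, map_mul, map_mul,
        map_one]
      rw [show ∑ a ∈ Finset.range b, f a = F - Φ by rw [hFb]; ring] at hUb hsucc
      generalize linProd s (fun a => ¬ φ a) t b = Et at *
      generalize linProd s (fun a => ¬ φ a) 1 b = E at *
      generalize linProd s φ 1 b = FX at *
      generalize (PowerSeries.C t : PowerSeries R) = T at *
      generalize (PowerSeries.C (s b) : PowerSeries R) = S at *
      generalize (PowerSeries.X : PowerSeries R) = Z at *
      linear_combination ih + FX * (E - T * Et) * hsucc - T * S * Z * FX * hUb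

end MasterIdentity

/-! ### Compatible permutations and words of flagged letters. -/

section Standardization

variable {n : ℕ}

/-- The exponent vector of the word `c`. -/
noncomputable def letterContent (c : Fin n → ℕ) : ℕ →₀ ℕ := ∑ j, Finsupp.single (c j) 1

theorem letterContent_apply (c : Fin n → ℕ) (a : ℕ) :
    letterContent c a = (Finset.univ.filter fun j => c j = a).card := by
  rw [letterContent, Finsupp.finsetSum_apply, Finset.card_filter]
  exact Finset.sum_congr rfl fun j _ => by rw [Finsupp.single_apply]

theorem letterContent_comp_perm (c : Fin n → ℕ) (σ : Equiv.Perm (Fin n)) :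
    letterContent (c ∘ σ) = letterContent c :=
  Equiv.sum_comp σ fun j => Finsupp.single (c j) 1

theorem exists_perm_of_letterContent_eq {c d : Fin n → ℕ} (h : letterContent c = letterContent d) :
    ∃ σ : Equiv.Perm (Fin n), c = d ∘ σ := by
  have hc : ∀ a, Nonempty ({j // c j = a} ≃ {j // d j = a}) := by
    intro a
    rw [← Fintype.card_eq, Fintype.card_subtype, Fintype.card_subtype, ← letterContent_apply,
      ← letterContent_apply, h]
  refine ⟨Equiv.ofFiberEquiv fun a => (hc a).some, funext fun j => ?_⟩
  exact (Equiv.ofFiberEquiv_map _ j).symm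

theorem eq_of_monotone_of_letterContent_eq {c d : Fin n → ℕ} (hc : Monotone c) (hd : Monotone d)
    (h : letterContent c = letterContent d) : c = d := by
  obtain ⟨σ, hσ⟩ := exists_perm_of_letterContent_eq h
  rw [hσ] at hc ⊢
  exact Tuple.unique_monotone (f := d) (σ := σ) (τ := 1) hc hd

/-- The letter `c i` at a weak non-excedance (flag `true`) or an excedance (flag `false`). -/
def flagged (c : Fin n → ℕ) (σ : Equiv.Perm (Fin n)) (i : Fin n) : ℕ ×ₗ Bool :=
  toLex (c i, decide (σ i ≤ i))

/-- The colouring `c` is compatible with `σ`: it is sorted, equal letters are sorted by excedances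
first and then by the values of `σ`, and the letters in `φ` are those of the fixed points. -/
def Compatible (φ : ℕ → Prop) (c : Fin n → ℕ) (σ : Equiv.Perm (Fin n)) : Prop :=
  Monotone (flagged c σ) ∧ (∀ i j, i < j → flagged c σ i = flagged c σ j → σ i < σ j) ∧
    ∀ i, φ (c i) ↔ σ i = i

/-- The word over the flagged letters that standardizes to `σ`. -/
def letterWord (c : Fin n → ℕ) (σ : Equiv.Perm (Fin n)) (j : Fin n) : ℕ ×ₗ Bool :=
  flagged c σ (σ.symm j)

/-- The flagged letter `x` may stand in position `j` of a word whose sorted letters are `c`. -/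
def Admits (φ : ℕ → Prop) (c : Fin n → ℕ) (j : Fin n) (x : ℕ ×ₗ Bool) : Prop :=
  if (ofLex x).2 then
    ((ofLex x).1 = c j ∧ φ (c j)) ∨ (¬ φ (ofLex x).1 ∧ ¬ φ (c j) ∧
      (c j < (ofLex x).1 ∨ ((ofLex x).1 = c j ∧ ∃ j', j < j' ∧ c j' = c j)))
  else
    ¬ φ (ofLex x).1 ∧ ¬ φ (c j) ∧
      ((ofLex x).1 < c j ∨ ((ofLex x).1 = c j ∧ ∃ j', j' < j ∧ c j' = c j))

/-- Position j = σ i holds the letter of i. If i < j, sortedness gives c i ≤ c j, and in case of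
equality i itself is the required earlier position with that letter. The case j < i is symmetric,
and σ i is fixed exactly when i is. -/
theorem Compatible.admits {φ : ℕ → Prop} {c : Fin n → ℕ} {σ : Equiv.Perm (Fin n)}
    (hc : Monotone c) (h : Compatible φ c σ) (j : Fin n) : Admits φ c j (letterWord c σ j) := by
  obtain ⟨i, rfl⟩ := σ.surjective j
  have hi := h.2.2 i
  have hj := h.2.2 (σ i)
  have hs : σ (σ i) = σ i ↔ σ i = i := σ.injective.eq_iff
  simp only [letterWord, flagged, Equiv.symm_apply_apply, Admits, ofLex_toLex,
    decide_eq_true_eq]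
  split_ifs with h1
  · rcases h1.eq_or_lt with h2 | h2
    · left
      rw [h2]
      exact ⟨rfl, hi.2 h2⟩
    · right
      refine ⟨fun hh => h2.ne (hi.1 hh), fun hh => h2.ne (hs.1 (hj.1 hh)), ?_⟩
      rcases (hc h2.le).lt_or_eq with h3 | h3
      · exact Or.inl h3
      · exact Or.inr ⟨h3.symm, i, h2, h3.symm⟩
  · rw [not_le] at h1
    refine ⟨fun hh => h1.ne' (hi.1 hh), fun hh => h1.ne' (hs.1 (hj.1 hh)), ?_⟩
    rcases (hc h1.le).lt_or_eq with h3 | h3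
    · exact Or.inl h3
    · exact Or.inr ⟨h3, i, h1, h3⟩

theorem Compatible.sort_letterWord {φ : ℕ → Prop} {c : Fin n → ℕ} {σ : Equiv.Perm (Fin n)}
    (h : Compatible φ c σ) : Tuple.sort (letterWord c σ) = σ := by
  symm
  rw [Tuple.eq_sort_iff]
  have : letterWord c σ ∘ σ = flagged c σ := by
    funext i; simp [letterWord]
  refine ⟨this ▸ h.1, fun i j hij he => h.2.1 i j hij ?_⟩
  simpa [letterWord] using he

theorem letterContent_letterWord (c : Fin n → ℕ) (σ : Equiv.Perm (Fin n)) :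
    letterContent (fun j => (ofLex (letterWord c σ j)).1) = letterContent c :=
  letterContent_comp_perm c σ.symm

section Converse

variable {φ : ℕ → Prop} {c : Fin n → ℕ} {u : Fin n → ℕ ×ₗ Bool}

theorem fst_sort_eq (hc : Monotone c) (hu : letterContent (fun j => (ofLex (u j)).1) = letterContent c)
    (i : Fin n) : (ofLex (u (Tuple.sort u i))).1 = c i := by
  have : (fun j => (ofLex (u j)).1) ∘ Tuple.sort u = c := by
    refine eq_of_monotone_of_letterContent_eq ?_ hc ((letterContent_comp_perm _ _).trans hu)
    intro i j hij
    exact Prod.Lex.monotone_fst _ _ (Tuple.monotone_sort u hij)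
  exact congrFun this i

theorem sort_lt_sort {i j : Fin n} (hij : i < j) (h : u (Tuple.sort u i) = u (Tuple.sort u j)) :
    Tuple.sort u i < Tuple.sort u j :=
  (Tuple.eq_sort_iff.1 rfl).2 i j hij h

theorem snd_sort_le {i j : Fin n} (hij : i ≤ j)
    (h : (ofLex (u (Tuple.sort u i))).1 = (ofLex (u (Tuple.sort u j))).1) :
    (ofLex (u (Tuple.sort u i))).2 ≤ (ofLex (u (Tuple.sort u j))).2 := by
  have := Tuple.monotone_sort u hij
  rw [Function.comp_apply, Function.comp_apply, Prod.Lex.le_iff] at this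
  rcases this with h1 | h1
  · exact absurd h h1.ne
  · exact h1.2

/-- The positional condition implies a global inequality, by induction inside a block of equal
letters. If the inequality fails at i, admissibility gives an earlier place in the block, so i - 1
lies in it, flagged as an excedance too. Then i - 1 < sort(i-1) < sort(i), contradicting sort(i) ≤
i. -/
theorem lt_sort_of_excedance (hc : Monotone c)
    (hu : letterContent (fun j => (ofLex (u j)).1) = letterContent c) (ha : ∀ j, Admits φ c j (u j))
    (i : Fin n) (hi : (ofLex (u (Tuple.sort u i))).2 = false) : i < Tuple.sort u i := by
  induction i using WellFoundedLT.induction with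
  | ind i ih =>
    by_contra hle
    rw [not_lt] at hle
    have hfst := fst_sort_eq hc hu
    have h1 := ha (Tuple.sort u i)
    simp only [Admits, hi, Bool.false_eq_true, if_false, hfst i] at h1
    obtain ⟨-, -, h1 | ⟨h1, j, hj, hcj⟩⟩ := h1
    · exact absurd (hc hle) (not_le.2 h1)
    · have hji : j < i := hj.trans_le hle
      have hc' : c j = c i := by rw [hcj, h1]
      have hn : (i : ℕ) - 1 < n := by omega
      obtain ⟨i', hi'⟩ : ∃ i' : Fin n, (i' : ℕ) = i - 1 := ⟨⟨_, hn⟩, rfl⟩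
      have hi'i : i' < i := by
        rw [Fin.lt_def] at hji ⊢; omega
      have hji' : j ≤ i' := by
        rw [Fin.lt_def] at hji; rw [Fin.le_def]; omega
      have hci' : c i' = c i := le_antisymm (hc hi'i.le) (hc' ▸ hc hji')
      have hs : (ofLex (u (Tuple.sort u i'))).2 = false := by
        have := snd_sort_le (u := u) hi'i.le (by rw [hfst, hfst, hci'])
        rw [hi] at this
        exact Bool.eq_false_of_le_false this
      have hlt := ih i' hi'i hs
      have hlt2 : Tuple.sort u i' < Tuple.sort u i := by
        refine sort_lt_sort hi'i (ofLex.injective (Prod.ext ?_ ?_))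
        · rw [hfst, hfst, hci']
        · rw [hs, hi]
      rw [Fin.lt_def] at hlt hlt2 hi'i
      rw [Fin.le_def] at hle
      omega

/-- Mirror image of `lt_sort_of_excedance`, by induction from the right end of the block. -/
theorem sort_lt_of_not_excedance (hc : Monotone c)
    (hu : letterContent (fun j => (ofLex (u j)).1) = letterContent c) (ha : ∀ j, Admits φ c j (u j))
    (i : Fin n) (hφ : ¬ φ (c i)) (hi : (ofLex (u (Tuple.sort u i))).2 = true) :
    Tuple.sort u i < i := by
  induction i using WellFoundedGT.induction with
  | ind i ih =>
    by_contra hle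
    rw [not_lt] at hle
    have hfst := fst_sort_eq hc hu
    have h1 := ha (Tuple.sort u i)
    simp only [Admits, hi, if_true, hfst i] at h1
    obtain h1 | ⟨-, -, h1 | ⟨h1, j, hj, hcj⟩⟩ := h1
    · exact hφ (h1.1 ▸ h1.2)
    · exact absurd (hc hle) (not_le.2 h1)
    · have hji : i < j := hle.trans_lt hj
      have hc' : c j = c i := by rw [hcj, h1]
      have hn : (i : ℕ) + 1 < n := by omega
      obtain ⟨i', hi'⟩ : ∃ i' : Fin n, (i' : ℕ) = i + 1 := ⟨⟨_, hn⟩, rfl⟩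
      have hi'i : i < i' := by
        rw [Fin.lt_def] at hji ⊢; omega
      have hji' : i' ≤ j := by
        rw [Fin.lt_def] at hji; rw [Fin.le_def]; omega
      have hci' : c i' = c i := le_antisymm (hc' ▸ hc hji') (hc hi'i.le)
      have hs : (ofLex (u (Tuple.sort u i'))).2 = true := by
        have := snd_sort_le (u := u) hi'i.le (by rw [hfst, hfst, hci'])
        rw [hi] at this
        exact Bool.eq_true_of_true_le this
      have hlt := ih i' hi'i (by rwa [hci']) hs
      have hlt2 : Tuple.sort u i < Tuple.sort u i' := by
        refine sort_lt_sort hi'i (ofLex.injective (Prod.ext ?_ ?_))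
        · rw [hfst, hfst, hci']
        · rw [hs, hi]
      rw [Fin.lt_def] at hlt hlt2 hi'i
      rw [Fin.le_def] at hle
      omega

theorem snd_sort_of_fixed (hc : Monotone c)
    (hu : letterContent (fun j => (ofLex (u j)).1) = letterContent c) (ha : ∀ j, Admits φ c j (u j))
    (i : Fin n) (hφ : φ (c i)) :
    (ofLex (u (Tuple.sort u i))).2 = true ∧ c (Tuple.sort u i) = c i := by
  have h1 := ha (Tuple.sort u i)
  have hfst := fst_sort_eq hc hu
  rw [Admits, hfst i] at h1
  split_ifs at h1 with h2
  · rcases h1 with h1 | h1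
    · exact ⟨h2, h1.1.symm⟩
    · exact absurd hφ h1.1
  · exact absurd hφ h1.1

/-- On a block of letters of φ the sort is an increasing map of the block into itself, hence the
identity. This is the inequality obtained from the left end; `sort_le_of_fixed` starts from the
right. -/
theorem le_sort_of_fixed (hc : Monotone c)
    (hu : letterContent (fun j => (ofLex (u j)).1) = letterContent c) (ha : ∀ j, Admits φ c j (u j))
    (i : Fin n) (hφ : φ (c i)) : i ≤ Tuple.sort u i := by
  induction i using WellFoundedLT.induction with
  | ind i ih =>
    by_contra hlt
    rw [not_le] at hlt
    have hfst := fst_sort_eq hc hu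
    obtain ⟨h1, h2⟩ := snd_sort_of_fixed hc hu ha i hφ
    have hn : (i : ℕ) - 1 < n := by omega
    obtain ⟨i', hi'⟩ : ∃ i' : Fin n, (i' : ℕ) = i - 1 := ⟨⟨_, hn⟩, rfl⟩
    have hi'i : i' < i := by
      rw [Fin.lt_def] at hlt ⊢; omega
    have hji' : Tuple.sort u i ≤ i' := by
      rw [Fin.lt_def] at hlt; rw [Fin.le_def]; omega
    have hci' : c i' = c i := le_antisymm (hc hi'i.le) (h2 ▸ hc hji')
    have h3 := ih i' hi'i (by rwa [hci'])
    have hlt2 : Tuple.sort u i' < Tuple.sort u i := by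
      refine sort_lt_sort hi'i (ofLex.injective (Prod.ext ?_ ?_))
      · rw [hfst, hfst, hci']
      · rw [h1, (snd_sort_of_fixed hc hu ha i' (by rwa [hci'])).1]
    exact absurd (h3.trans_lt hlt2) (not_lt.2 hji')

theorem sort_le_of_fixed (hc : Monotone c)
    (hu : letterContent (fun j => (ofLex (u j)).1) = letterContent c) (ha : ∀ j, Admits φ c j (u j))
    (i : Fin n) (hφ : φ (c i)) : Tuple.sort u i ≤ i := by
  induction i using WellFoundedGT.induction with
  | ind i ih =>
    by_contra hlt
    rw [not_le] at hlt
    have hfst := fst_sort_eq hc hu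
    obtain ⟨h1, h2⟩ := snd_sort_of_fixed hc hu ha i hφ
    have hn : (i : ℕ) + 1 < n := by omega
    obtain ⟨i', hi'⟩ : ∃ i' : Fin n, (i' : ℕ) = i + 1 := ⟨⟨_, hn⟩, rfl⟩
    have hi'i : i < i' := by
      rw [Fin.lt_def] at hlt ⊢; omega
    have hji' : i' ≤ Tuple.sort u i := by
      rw [Fin.lt_def] at hlt; rw [Fin.le_def]; omega
    have hci' : c i' = c i := le_antisymm (h2 ▸ hc hji') (hc hi'i.le)
    have h3 := ih i' hi'i (by rwa [hci'])
    have hlt2 : Tuple.sort u i < Tuple.sort u i' := by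
      refine sort_lt_sort hi'i (ofLex.injective (Prod.ext ?_ ?_))
      · rw [hfst, hfst, hci']
      · rw [h1, (snd_sort_of_fixed hc hu ha i' (by rwa [hci'])).1]
    exact absurd (hlt2.trans_le h3) (not_lt.2 hji')

theorem flagged_sort (hc : Monotone c)
    (hu : letterContent (fun j => (ofLex (u j)).1) = letterContent c) (ha : ∀ j, Admits φ c j (u j)) :
    flagged c (Tuple.sort u) = u ∘ Tuple.sort u := by
  funext i
  refine ofLex.injective (Prod.ext ?_ ?_)
  · exact (fst_sort_eq hc hu i).symm
  · simp only [flagged, ofLex_toLex, Function.comp_apply]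
    cases h : (ofLex (u (Tuple.sort u i))).2 with
    | false =>
      have := lt_sort_of_excedance hc hu ha i h
      simpa using this
    | true =>
      by_cases hφ : φ (c i)
      · simpa using sort_le_of_fixed hc hu ha i hφ
      · simpa using (sort_lt_of_not_excedance hc hu ha i hφ h).le

theorem letterWord_sort (hc : Monotone c)
    (hu : letterContent (fun j => (ofLex (u j)).1) = letterContent c) (ha : ∀ j, Admits φ c j (u j)) :
    letterWord c (Tuple.sort u) = u := by
  funext j
  rw [letterWord, flagged_sort hc hu ha]
  simp

theorem compatible_sort (hc : Monotone c)
    (hu : letterContent (fun j => (ofLex (u j)).1) = letterContent c) (ha : ∀ j, Admits φ c j (u j)) :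
    Compatible φ c (Tuple.sort u) := by
  rw [Compatible, flagged_sort hc hu ha]
  refine ⟨Tuple.monotone_sort u, fun i j hij h => sort_lt_sort hij h, fun i => ⟨fun h => ?_,
    fun h => ?_⟩⟩
  · exact le_antisymm (sort_le_of_fixed hc hu ha i h) (le_sort_of_fixed hc hu ha i h)
  · by_contra hφ
    cases h1 : (ofLex (u (Tuple.sort u i))).2 with
    | false => exact (lt_sort_of_excedance hc hu ha i h1).ne' h
    | true => exact (sort_lt_of_not_excedance hc hu ha i hφ h1).ne h

end Converse

end Standardization

/-! ### Compatible pairs as a diagonal series. -/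

section CompatibleEnumeration

variable {R : Type*} [CommRing R] {n : ℕ}

theorem prod_X_eq_monomial (c : Fin n → ℕ) :
    ∏ j, (MvPolynomial.X (c j) : MvPolynomial ℕ R) =
      MvPolynomial.monomial (letterContent c) 1 := by
  rw [letterContent, MvPolynomial.monomial_sum_one]
  rfl

open Classical in
/-- The linear form enumerating the letters admitted in position `j`. -/
noncomputable def positionForm (φ : ℕ → Prop) (t : R) (N : ℕ) (c : Fin n → ℕ) (j : Fin n) :
    MvPolynomial ℕ R :=
  ∑ x ∈ Finset.range N ×ˢ (Finset.univ : Finset Bool),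
    if Admits φ c j (toLex x) then
      MvPolynomial.C (if x.2 then 1 else t) * MvPolynomial.X x.1 else 0

theorem prod_flag_eq_pow_excNumber (t : R) (c : Fin n → ℕ) (σ : Equiv.Perm (Fin n)) :
    ∏ j, (if (ofLex (letterWord c σ j)).2 then 1 else t) = t ^ excNumber σ := by
  rw [← Equiv.prod_comp σ, excNumber, ← Finset.prod_const, Finset.prod_filter]
  refine Finset.prod_congr rfl fun i _ => ?_
  simp only [letterWord, flagged, Equiv.symm_apply_apply, ofLex_toLex, decide_eq_true_eq]
  by_cases h : σ i ≤ i
  · rw [if_pos h, if_neg (not_lt.2 h)]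
  · rw [if_neg h, if_pos (not_le.1 h)]

-- Expanding the product chooses an admitted flagged letter at each position, and the monomial
-- prescribes the content. `letterWord` and stable sorting are mutually inverse between compatible
-- permutations and such words.
open Classical in
theorem sum_compatible_eq_coeff (φ : ℕ → Prop) (t : R) {N : ℕ} {c : Fin n → ℕ}
    (hc : Monotone c) (hN : ∀ j, c j < N) :
    ∑ σ : Equiv.Perm (Fin n) with Compatible φ c σ, t ^ excNumber σ =
      MvPolynomial.coeff (letterContent c) (∏ j, positionForm φ t N c j) := by
  simp only [positionForm]
  rw [Finset.prod_univ_sum, MvPolynomial.coeff_sum]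
  have h1 : ∀ u ∈ Fintype.piFinset
      (fun _ : Fin n => Finset.range N ×ˢ (Finset.univ : Finset Bool)),
      MvPolynomial.coeff (letterContent c) (∏ j, if Admits φ c j (toLex (u j)) then
        MvPolynomial.C (if (u j).2 then (1 : R) else t) * MvPolynomial.X (u j).1 else 0) =
      if (∀ j, Admits φ c j (toLex (u j))) ∧ letterContent (fun j => (u j).1) = letterContent c
        then ∏ j, (if (u j).2 then (1 : R) else t) else 0 := by
    intro u _
    rw [Finset.prod_ite_zero]
    simp only [Finset.mem_univ, true_imp_iff]
    by_cases ha : ∀ j, Admits φ c j (toLex (u j))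
    · rw [if_pos ha, Finset.prod_mul_distrib, ← map_prod, prod_X_eq_monomial,
        MvPolynomial.coeff_C_mul, MvPolynomial.coeff_monomial]
      simp [ha]
    · rw [if_neg ha, if_neg (fun h => ha h.1), MvPolynomial.coeff_zero]
  rw [Finset.sum_congr rfl h1, ← Finset.sum_filter]
  refine Finset.sum_bij' (fun σ _ j => ofLex (letterWord c σ j))
    (fun u _ => Tuple.sort fun j => toLex (u j)) ?_ ?_ ?_ ?_ ?_
  · intro σ hσ
    have hσ' := (Finset.mem_filter.1 hσ).2
    rw [Finset.mem_filter, Fintype.mem_piFinset]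
    refine ⟨fun j => ?_, fun j => hσ'.admits hc j, letterContent_letterWord c σ⟩
    simpa [letterWord, flagged, hN] using le_or_gt _ _
  · intro u hu
    obtain ⟨-, h1, h2⟩ := Finset.mem_filter.1 hu
    exact Finset.mem_filter.2 ⟨Finset.mem_univ _, compatible_sort hc h2 h1⟩
  · intro σ hσ
    exact (Finset.mem_filter.1 hσ).2.sort_letterWord
  · intro u hu
    obtain ⟨-, h1, h2⟩ := Finset.mem_filter.1 hu
    funext j
    have := congrFun (letterWord_sort (u := fun j => toLex (u j)) hc h2 h1) j
    simp only [this, ofLex_toLex]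
  · intro σ _
    exact (prod_flag_eq_pow_excNumber t c σ).symm

variable (φ : ℕ → Prop) [DecidablePred φ]

-- A loop in a row outside φ has weight 1 + t because it may carry either flag. The first position
-- of the row forbids the excedance flag, and the last one the other flag.
open Classical in
theorem positionForm_eq (t : R) {N : ℕ} {c : Fin n → ℕ} {j : Fin n} (hj : c j < N) :
    positionForm φ t N c j = if φ (c j) then rowForm φ t N (c j) else
      rowForm φ t N (c j) -
        (if ∃ j', j' < j ∧ c j' = c j then 0 else MvPolynomial.C t * MvPolynomial.X (c j)) -
        (if ∃ j', j < j' ∧ c j' = c j then 0 else MvPolynomial.X (c j)) := by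
  have hsum : ∀ (P : Prop) [Decidable P] (f : MvPolynomial ℕ R),
      (if P then 0 else f) =
        ∑ a ∈ Finset.range N, if a = c j then (if P then 0 else f) else 0 := by
    intro P _ f
    rw [Finset.sum_ite_eq', if_pos (Finset.mem_range.2 hj)]
  have hsplit : (if φ (c j) then rowForm φ t N (c j) else
      rowForm φ t N (c j) -
        (if ∃ j', j' < j ∧ c j' = c j then 0 else MvPolynomial.C t * MvPolynomial.X (c j)) -
        (if ∃ j', j < j' ∧ c j' = c j then 0 else MvPolynomial.X (c j))) =
      ∑ a ∈ Finset.range N, (if φ (c j) then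
          MvPolynomial.C (rowWeight φ t (c j) a) * MvPolynomial.X a else
        MvPolynomial.C (rowWeight φ t (c j) a) * MvPolynomial.X a -
        (if a = c j then (if ∃ j', j' < j ∧ c j' = c j then 0 else
          MvPolynomial.C t * MvPolynomial.X (c j)) else 0) -
        (if a = c j then (if ∃ j', j < j' ∧ c j' = c j then 0 else
          MvPolynomial.X (c j)) else 0)) := by
    by_cases h : φ (c j)
    · simp only [if_pos h]; rfl
    · simp only [if_neg h]
      rw [Finset.sum_sub_distrib, Finset.sum_sub_distrib, ← hsum, ← hsum]; rfl
  rw [hsplit, positionForm, Finset.sum_product]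
  refine Finset.sum_congr rfl fun a _ => ?_
  simp only [Fintype.sum_bool, Admits, ofLex_toLex, if_true, Bool.false_eq_true, if_false,
    rowWeight]
  by_cases hac : a = c j
  · subst hac
    by_cases h : φ (c j)
    · simp [h]
    · by_cases h1 : ∃ j', j' < j ∧ c j' = c j <;> by_cases h2 : ∃ j', j < j' ∧ c j' = c j <;>
        simp only [h, h1, h2, lt_irrefl, if_true, if_false, and_true, and_false, or_true, or_false,
          not_false_eq_true, map_add, map_one] <;> ring
  · by_cases h : φ (c j)
    · simp [h, hac, Ne.symm hac]
    · by_cases ha : φ a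
      · simp [h, ha, hac, Ne.symm hac]
      · rcases lt_or_gt_of_ne hac with h1 | h1
        · simp [h, ha, hac, Ne.symm hac, h1, h1.not_gt]
        · simp [h, ha, hac, Ne.symm hac, h1, h1.not_gt]

/-- The enumerator of the words of length `k` in the row of `b`: a word neither begins with the
excedance loop `b` nor ends with the non-excedance loop `b`. -/
noncomputable def rowWords (φ : ℕ → Prop) [DecidablePred φ] (t : R) (N b : ℕ) :
    ℕ → MvPolynomial ℕ R
  | 0 => 1
  | 1 => if φ b then rowForm φ t N b else
      rowForm φ t N b - MvPolynomial.C t * MvPolynomial.X b - MvPolynomial.X b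
  | k + 2 => if φ b then rowForm φ t N b ^ (k + 2) else
      (rowForm φ t N b - MvPolynomial.C t * MvPolynomial.X b) *
        (rowForm φ t N b - MvPolynomial.X b) * rowForm φ t N b ^ k

-- Only the least and the greatest element of T receive a correction; for a singleton both fall on
-- the same factor.
open Classical in
theorem prod_first_last {S : Type*} [CommRing S] {T : Finset (Fin n)} (hT : T.Nonempty)
    (x y z : S) :
    ∏ j ∈ T, (x - (if ∃ j' ∈ T, j' < j then 0 else y) - (if ∃ j' ∈ T, j < j' then 0 else z)) =
      if T.card = 1 then x - y - z else (x - y) * (x - z) * x ^ (T.card - 2) := by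
  have hmin : ∀ j ∈ T, (∃ j' ∈ T, j' < j) ↔ j ≠ T.min' hT := by
    intro j hj
    constructor
    · rintro ⟨j', h1, h2⟩ rfl
      exact absurd (T.min'_le j' h1) (not_le.2 h2)
    · intro h
      exact ⟨_, T.min'_mem hT, lt_of_le_of_ne (T.min'_le j hj) (Ne.symm h)⟩
  have hmax : ∀ j ∈ T, (∃ j' ∈ T, j < j') ↔ j ≠ T.max' hT := by
    intro j hj
    constructor
    · rintro ⟨j', h1, h2⟩ rfl
      exact absurd (T.le_max' j' h1) (not_le.2 h2)
    · intro h
      exact ⟨_, T.max'_mem hT, lt_of_le_of_ne (T.le_max' j hj) h⟩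
  have hcongr : ∏ j ∈ T, (x - (if ∃ j' ∈ T, j' < j then 0 else y) -
      (if ∃ j' ∈ T, j < j' then 0 else z)) =
      ∏ j ∈ T, (x - (if j = T.min' hT then y else 0) - (if j = T.max' hT then z else 0)) := by
    refine Finset.prod_congr rfl fun j hj => ?_
    simp only [hmin j hj, hmax j hj, ne_eq, ite_not]
  rw [hcongr]
  split_ifs with h1
  · obtain ⟨a, rfl⟩ := Finset.card_eq_one.1 h1
    simp
  · have hne : T.min' hT ≠ T.max' hT := by
      intro h
      apply h1
      rw [Finset.card_eq_one]
      refine ⟨T.min' hT, Finset.eq_singleton_iff_unique_mem.2 ⟨T.min'_mem hT, fun a ha => ?_⟩⟩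
      exact le_antisymm (h ▸ T.le_max' a ha) (T.min'_le a ha)
    have hmem : T.max' hT ∈ T.erase (T.min' hT) :=
      Finset.mem_erase.2 ⟨hne.symm, T.max'_mem hT⟩
    rw [← Finset.mul_prod_erase T _ (T.min'_mem hT), ← Finset.mul_prod_erase _ _ hmem,
      if_pos rfl, if_neg hne, if_neg hne.symm, if_pos rfl, sub_zero, sub_zero, mul_assoc]
    congr 2
    rw [Finset.prod_congr rfl (g := fun _ => x), Finset.prod_const, Finset.card_erase_of_mem hmem,
      Finset.card_erase_of_mem (T.min'_mem hT)]
    · congr 1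
    · intro j hj
      rw [Finset.mem_erase, Finset.mem_erase] at hj
      rw [if_neg hj.2.1, if_neg hj.1, sub_zero, sub_zero]

/-- Grouping positions by their sorted letter shows that the product depends on c only through its
content, which is what makes the enumerator a diagonal series. -/
theorem prod_positionForm (t : R) {N : ℕ} {c : Fin n → ℕ} (hN : ∀ j, c j < N) :
    ∏ j, positionForm φ t N c j =
      ∏ b ∈ Finset.range N, rowWords φ t N b (letterContent c b) := by
  classical
  rw [← Finset.prod_fiberwise_of_maps_to (t := Finset.range N) (g := c)
    (fun j _ => Finset.mem_range.2 (hN j))]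
  refine Finset.prod_congr rfl fun b hb => ?_
  rw [letterContent_apply]
  set T := Finset.univ.filter fun j => c j = b with hT
  have hmem : ∀ j, j ∈ T ↔ c j = b := by simp [hT]
  rcases T.eq_empty_or_nonempty with h0 | h0
  · rw [h0]; simp [rowWords]
  · by_cases hφ : φ b
    · rw [Finset.prod_congr rfl (g := fun _ => rowForm φ t N b), Finset.prod_const]
      · rcases hk : T.card with _ | _ | k <;> simp [rowWords, hφ]
      · intro j hj
        have := (hmem j).1 hj
        rw [positionForm_eq φ t (hN j), this, if_pos hφ]
    · have hcongr : ∏ j ∈ T, positionForm φ t N c j = ∏ j ∈ T, (rowForm φ t N b -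
          (if ∃ j' ∈ T, j' < j then 0 else MvPolynomial.C t * MvPolynomial.X b) -
          (if ∃ j' ∈ T, j < j' then 0 else MvPolynomial.X b)) := by
        refine Finset.prod_congr rfl fun j hj => ?_
        have := (hmem j).1 hj
        rw [positionForm_eq φ t (hN j), this, if_neg hφ]
        simp only [hmem, and_comm]
      rw [hcongr, prod_first_last h0]
      have := h0.card_pos
      rcases hk : T.card with _ | _ | k
      · omega
      · simp [rowWords, hφ]
      · simp [rowWords, hφ]

theorem exists_monotone_letterContent_eq {N : ℕ} {μ : ℕ →₀ ℕ}
    (hμ : μ ∈ (Finset.range N).finsuppAntidiag n) :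
    ∃ c : Fin n → ℕ, Monotone c ∧ (∀ j, c j < N) ∧ letterContent c = μ := by
  rw [Finset.mem_finsuppAntidiag'] at hμ
  obtain ⟨l, hl⟩ := Quot.exists_rep (Finsupp.toMultiset μ)
  have hcard : l.length = n := by
    have := Finsupp.card_toMultiset μ
    rw [← hl] at this
    exact this.trans hμ.1
  subst hcard
  set d : Fin l.length → ℕ := fun j => l.get j with hd
  have hcd : letterContent d = μ := by
    apply (Finsupp.orderIsoMultiset (ι := ℕ)).injective
    rw [Finsupp.coe_orderIsoMultiset, ← hl, letterContent, Finsupp.toMultiset_sum]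
    simp only [Finsupp.toMultiset_single, one_smul, hd, List.get_eq_getElem]
    rw [Fin.sum_univ_fun_getElem l fun a => ({a} : Multiset ℕ)]
    exact Multiset.sum_map_singleton (l : Multiset ℕ)
  refine ⟨d ∘ Tuple.sort d, Tuple.monotone_sort d, fun j => ?_, ?_⟩
  · have : d (Tuple.sort d j) ∈ μ.support := by
      rw [← Finsupp.mem_toMultiset, ← hl]
      exact List.get_mem _ _
    exact Finset.mem_range.1 (hμ.2 this)
  · rw [letterContent_comp_perm, hcd]

theorem letterContent_mem {N : ℕ} {c : Fin n → ℕ} (hN : ∀ j, c j < N) :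
    letterContent c ∈ (Finset.range N).finsuppAntidiag n := by
  rw [Finset.mem_finsuppAntidiag']
  constructor
  · have := Finsupp.card_toMultiset (letterContent c)
    rw [letterContent, map_sum] at this
    simp at this
    exact this.symm
  · intro a ha
    rw [Finsupp.mem_support_iff, letterContent_apply] at ha
    obtain ⟨j, hj⟩ := Finset.card_pos.1 (Nat.pos_of_ne_zero ha)
    rw [← (Finset.mem_filter.1 hj).2]
    exact Finset.mem_range.2 (hN j)

theorem weightPow_letterContent (s : ℕ → R) (c : Fin n → ℕ) :
    weightPow s (letterContent c) = ∏ j, s (c j) := by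
  have : ∀ T : Finset (Fin n), weightPow s (∑ j ∈ T, Finsupp.single (c j) 1) =
      ∏ j ∈ T, s (c j) := by
    intro T
    induction T using Finset.induction_on with
    | empty => simp [weightPow]
    | insert a T ha ih =>
      rw [Finset.sum_insert ha, Finset.prod_insert ha, add_comm, weightPow_add_single, ih]
  exact this _

open Classical in
theorem sum_monotone_eq_sum_finsuppAntidiag (N : ℕ) (f : (ℕ →₀ ℕ) → R) :
    ∑ c ∈ Fintype.piFinset (fun _ : Fin n => Finset.range N) with Monotone c,
      f (letterContent c) = ∑ μ ∈ (Finset.range N).finsuppAntidiag n, f μ := by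
  have hmem : ∀ c : Fin n → ℕ, c ∈ Fintype.piFinset (fun _ : Fin n => Finset.range N) ↔
      ∀ j, c j < N := by
    simp
  refine Finset.sum_bij (fun c _ => letterContent c) ?_ ?_ ?_ (fun _ _ => rfl)
  · intro c hc
    exact letterContent_mem ((hmem c).1 (Finset.mem_filter.1 hc).1)
  · intro c hc d hd h
    exact eq_of_monotone_of_letterContent_eq (Finset.mem_filter.1 hc).2 (Finset.mem_filter.1 hd).2 h
  · intro μ hμ
    obtain ⟨c, h1, h2, h3⟩ := exists_monotone_letterContent_eq hμ
    exact ⟨c, Finset.mem_filter.2 ⟨(hmem c).2 h2, h1⟩, h3⟩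

theorem Compatible.monotone {ψ : ℕ → Prop} {c : Fin n → ℕ} {σ : Equiv.Perm (Fin n)}
    (h : Compatible ψ c σ) : Monotone c :=
  fun _ _ hij => Prod.Lex.monotone_fst _ _ (h.1 hij)

open Classical in
/-- The enumerator of the compatible pairs is a diagonal series. -/
theorem sum_compatible_eq_diagSeries (t : R) (s : ℕ → R) (N : ℕ) :
    ∑ σ : Equiv.Perm (Fin n), t ^ excNumber σ *
        ∑ c ∈ Fintype.piFinset (fun _ : Fin n => Finset.range N) with Compatible φ c σ,
          ∏ j, s (c j) =
      PowerSeries.coeff n (diagSeries (Finset.range N) s 0 1 (rowWords φ t N)) := by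
  rw [diagSeries, PowerSeries.coeff_mk, ← sum_monotone_eq_sum_finsuppAntidiag]
  simp only [Finset.sum_filter, Finset.mul_sum]
  rw [Finset.sum_comm]
  refine Finset.sum_congr rfl fun c hc => ?_
  have hN : ∀ j, c j < N := by simpa using hc
  split_ifs with hm
  · rw [add_zero, one_mul, ← prod_positionForm φ t hN, ← sum_compatible_eq_coeff φ t hm hN,
      weightPow_letterContent, Finset.mul_sum, Finset.sum_filter]
    refine Finset.sum_congr rfl fun σ _ => ?_
    split_ifs <;> ring
  · refine Finset.sum_eq_zero fun σ _ => ?_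
    rw [if_neg fun h => hm h.monotone, mul_zero]

end CompatibleEnumeration

/-! ### Removing the forbidden loops at the ends of the rows. -/

section RowWordSeries

variable {R : Type*} [CommRing R]

theorem diagSeries_congr {B : Finset ℕ} (s : ℕ → R) (ν : ℕ →₀ ℕ) (g : MvPolynomial ℕ R)
    {W W' : ℕ → ℕ → MvPolynomial ℕ R} (h : ∀ b ∈ B, W b = W' b) :
    diagSeries B s ν g W = diagSeries B s ν g W' := by
  ext n
  simp only [diagSeries, PowerSeries.coeff_mk]
  refine Finset.sum_congr rfl fun μ _ => ?_
  rw [Finset.prod_congr rfl fun b hb => by rw [h b hb]]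

variable (φ : ℕ → Prop) [DecidablePred φ] (t : R) (s : ℕ → R) (N : ℕ)

/-- The enumerator of the words in the row of `b` that do not begin with the excedance loop. -/
noncomputable def rowPrefixWords (b : ℕ) : ℕ → MvPolynomial ℕ R
  | 0 => 1
  | k + 1 => (rowForm φ t N b - MvPolynomial.C t * MvPolynomial.X b) * rowForm φ t N b ^ k

/-- Rows are converted one at a time by two applications of `diagSeries_update`: forbidding the
initial excedance loop costs a factor 1 - t s_b z, and forbidding the final non-excedance loop a
factor 1 - s_b z. -/
theorem diagSeries_rowWords_aux {M : ℕ} (hM : M ≤ N) :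
    diagSeries (Finset.range N) s 0 1
        (fun b => if b < M then rowWords φ t N b else fun k => rowForm φ t N b ^ k) =
      linProd s (fun a => ¬ φ a) 1 M * linProd s (fun a => ¬ φ a) t M *
        rowSeries φ t s N N 0 1 := by
  induction M with
  | zero => simp [linProd, rowSeries]
  | succ b ih =>
    specialize ih (by omega)
    have hb : b ∈ Finset.range N := Finset.mem_range.2 hM
    by_cases hφ : φ b
    · rw [linProd_succ_of_neg s (not_not.2 hφ), linProd_succ_of_neg s (not_not.2 hφ), ← ih]
      refine diagSeries_congr _ _ _ fun a _ => ?_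
      by_cases hab : a = b
      · subst hab
        rw [if_pos (Nat.lt_succ_self a), if_neg (lt_irrefl a)]
        funext k
        rcases k with _ | _ | k <;> simp [rowWords, hφ]
      · simp only [show a < b + 1 ↔ a < b by omega]
    · rw [linProd_succ_of_pos (ψ := fun a => ¬ φ a) s hφ,
        linProd_succ_of_pos (ψ := fun a => ¬ φ a) s hφ]
      have h1 := diagSeries_update hb s t
        (fun a => if a < b then rowWords φ t N a else fun k => rowForm φ t N a ^ k)
        (fun a => if a < b then rowWords φ t N a else if a = b then rowPrefixWords φ t N b else
          fun k => rowForm φ t N a ^ k)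
        (fun a _ hab => by simp [hab]) (by simp [rowPrefixWords])
        (fun k => by simp only [lt_irrefl, if_false, if_true, rowPrefixWords]; ring)
      have h2 := diagSeries_update hb s 1
        (fun a => if a < b then rowWords φ t N a else if a = b then rowPrefixWords φ t N b else
          fun k => rowForm φ t N a ^ k)
        (fun a => if a < b + 1 then rowWords φ t N a else fun k => rowForm φ t N a ^ k)
        (fun a _ hab => by simp [hab, show a < b + 1 ↔ a < b by omega])
        (by simp [rowPrefixWords, rowWords])
        (fun k => by
          rcases k with _ | k
          · simp [rowPrefixWords, rowWords, hφ]
          · simp only [lt_irrefl, if_false, if_true, rowPrefixWords, rowWords, hφ,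
              Nat.lt_succ_self, map_one]
            ring)
      rw [h2, h1, ih, linFactor, linFactor]
      ring

/-- The generating function of the compatible pairs. -/
theorem diagSeries_rowWords_mul_eq :
    diagSeries (Finset.range N) s 0 1 (rowWords φ t N) * linProd s φ 1 N *
      (linProd s (fun a => ¬ φ a) 1 N - PowerSeries.C t * linProd s (fun a => ¬ φ a) t N) =
        (1 - PowerSeries.C t) *
          (linProd s (fun a => ¬ φ a) 1 N * linProd s (fun a => ¬ φ a) t N) := by
  have h1 := diagSeries_rowWords_aux φ t s N le_rfl
  rw [diagSeries_congr s 0 1 (W' := rowWords φ t N)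
    (fun b hb => by rw [if_pos (Finset.mem_range.1 hb)])] at h1
  rw [h1, ← rowSeries_mul_eq φ t s N le_rfl]
  ring

end RowWordSeries

/-! ### The polynomials h_n(1, q, ..., q^(m-1)) and their generating functions. -/

section CompleteHomogeneous

variable {R : Type*} [CommRing R] (q : R)

/-- The complete homogeneous symmetric polynomial `h_n(1, q, ..., q^(m-1))`. -/
def hq : ℕ → ℕ → R
  | 0, _ => 1
  | n + 1, m => ∑ x ∈ Finset.range m, q ^ x * hq n (x + 1)

theorem hq_zero_left (m : ℕ) : hq q 0 m = 1 := by rw [hq]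

theorem hq_succ (n m : ℕ) : hq q (n + 1) m = ∑ x ∈ Finset.range m, q ^ x * hq q n (x + 1) := by
  rw [hq]

theorem hq_zero_right {n : ℕ} (hn : n ≠ 0) : hq q n 0 = 0 := by
  obtain ⟨n, rfl⟩ := Nat.exists_eq_succ_of_ne_zero hn
  rw [Nat.succ_eq_add_one, hq_succ, Finset.sum_range_zero]

theorem hq_one_right (n : ℕ) : hq q n 1 = 1 := by
  induction n with
  | zero => rw [hq_zero_left]
  | succ n ih => rw [hq_succ, Finset.sum_range_one, pow_zero, one_mul, zero_add, ih]

/-- The generating function of `c ^ n * h_n(1, q, ..., q^(m-1))`. -/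
noncomputable def hqSeries (c : R) (m : ℕ) : PowerSeries R :=
  PowerSeries.mk fun n => c ^ n * hq q n m

theorem hqSeries_succ (c : R) (m : ℕ) :
    hqSeries q c (m + 1) * (1 - PowerSeries.C (c * q ^ m) * PowerSeries.X) = hqSeries q c m := by
  ext n
  rw [mul_sub, mul_one, map_sub, ← mul_assoc, mul_comm (hqSeries q c (m + 1)), mul_assoc,
    PowerSeries.coeff_C_mul]
  cases n with
  | zero => simp [hqSeries, hq_zero_left]
  | succ n =>
    rw [PowerSeries.coeff_succ_mul_X]
    simp only [hqSeries, PowerSeries.coeff_mk]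
    rw [hq_succ, hq_succ, Finset.sum_range_succ]
    ring

theorem hqSeries_mul_prod (c : R) (m : ℕ) :
    hqSeries q c m *
      ∏ i ∈ Finset.range m, (1 - PowerSeries.C (c * q ^ i) * PowerSeries.X) = 1 := by
  induction m with
  | zero =>
    rw [Finset.prod_range_zero, mul_one]
    ext n
    cases n with
    | zero => simp [hqSeries, hq_zero_left]
    | succ n => simp [hqSeries, hq_zero_right, PowerSeries.coeff_one]
  | succ m ih => rw [Finset.prod_range_succ, mul_comm (∏ i ∈ _, _), ← mul_assoc, hqSeries_succ, ih]

/-- The series `1 - ∑ t [i - 1]_t h_i z^i`. -/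
noncomputable def derDenom (t : R) (m : ℕ) : PowerSeries R :=
  PowerSeries.mk fun n =>
    if n = 0 then 1 else -(t * (∑ l ∈ Finset.range (n - 1), t ^ l) * hq q n m)

/-- The generating function for the compatible pairs without fixed points. -/
noncomputable def derSeries (t : R) (m : ℕ) : PowerSeries R :=
  PowerSeries.invOfUnit (derDenom q t m) 1

theorem derDenom_mul_derSeries (t : R) (m : ℕ) : derDenom q t m * derSeries q t m = 1 :=
  PowerSeries.mul_invOfUnit _ _ (by
    rw [← PowerSeries.coeff_zero_eq_constantCoeff_apply]; simp [derDenom])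

theorem coeff_zero_derSeries (t : R) (m : ℕ) : PowerSeries.coeff 0 (derSeries q t m) = 1 := by
  have h := congrArg (PowerSeries.coeff 0) (derDenom_mul_derSeries q t m)
  rw [PowerSeries.coeff_mul] at h
  simpa [derDenom] using h

theorem coeff_succ_derSeries (t : R) (m n : ℕ) :
    PowerSeries.coeff (n + 1) (derSeries q t m) = ∑ i ∈ Finset.range (n + 1),
      t * (∑ l ∈ Finset.range i, t ^ l) * hq q (i + 1) m *
        PowerSeries.coeff (n - i) (derSeries q t m) := by
  have h := congrArg (PowerSeries.coeff (n + 1)) (derDenom_mul_derSeries q t m)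
  rw [PowerSeries.coeff_mul, Finset.Nat.sum_antidiagonal_eq_sum_range_succ
    (fun i j => PowerSeries.coeff i (derDenom q t m) * PowerSeries.coeff j (derSeries q t m)),
    Finset.sum_range_succ'] at h
  simp only [derDenom, PowerSeries.coeff_mk, Nat.add_eq_zero_iff, one_ne_zero, and_false,
    if_false, if_true, one_mul, Nat.add_sub_cancel, PowerSeries.coeff_one, neg_mul,
    Finset.sum_neg_distrib, Nat.sub_zero, Nat.add_sub_add_right] at h
  linear_combination h

/-- For n ≥ 1, (1 - t) t [n-1]_t = t - t^n. This identifies the denominator without division by 1 -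
t with the form produced by the master identity. -/
theorem one_sub_mul_derDenom (t : R) (m : ℕ) :
    (1 - PowerSeries.C t) * derDenom q t m =
      hqSeries q t m - PowerSeries.C t * hqSeries q 1 m := by
  ext n
  rw [sub_mul, one_mul, map_sub, map_sub, PowerSeries.coeff_C_mul, PowerSeries.coeff_C_mul]
  simp only [derDenom, hqSeries, PowerSeries.coeff_mk]
  cases n with
  | zero => simp [hq_zero_left]
  | succ n =>
    rw [if_neg (Nat.succ_ne_zero n), Nat.add_sub_cancel, one_pow]
    linear_combination (-(t * hq q (n + 1) m)) * mul_neg_geom_sum t n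

/-- The constant term of the first series contributes the next coefficient of D, whose recursion has
factors t [i]_t. Together with the other terms they become 1 + t [i]_t = [i+1]_t. -/
theorem coeff_hqSeries_mul_derSeries (t : R) (m n : ℕ) :
    PowerSeries.coeff (n + 1) (hqSeries q 1 m * derSeries q t m) = ∑ i ∈ Finset.range (n + 1),
      (∑ l ∈ Finset.range (i + 1), t ^ l) * hq q (i + 1) m *
        PowerSeries.coeff (n - i) (derSeries q t m) := by
  rw [PowerSeries.coeff_mul, Finset.Nat.sum_antidiagonal_eq_sum_range_succ
    (fun i j => PowerSeries.coeff i (hqSeries q 1 m) * PowerSeries.coeff j (derSeries q t m)),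
    Finset.sum_range_succ', Nat.sub_zero, coeff_succ_derSeries]
  simp only [hqSeries, PowerSeries.coeff_mk, one_pow, one_mul, hq_zero_left,
    Nat.add_sub_add_right]
  rw [← Finset.sum_add_distrib]
  refine Finset.sum_congr rfl fun i _ => ?_
  rw [geom_sum_succ]
  ring

end CompleteHomogeneous

/-! ### Specializing the weights of the letters. -/

section Specialization

variable {R : Type*} [CommRing R]

theorem prod_filter_odd {S : Type*} [CommMonoid S] (f : ℕ → S) (m : ℕ) :
    ∏ b ∈ (Finset.range (2 * m + 1)).filter (fun b => ¬ Even b), f b =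
      ∏ i ∈ Finset.range m, f (2 * i + 1) := by
  induction m with
  | zero => simp [Finset.filter_singleton]
  | succ m ih =>
    rw [show 2 * (m + 1) + 1 = 2 * m + 1 + 1 + 1 by ring, Finset.prod_filter,
      Finset.prod_range_succ, Finset.prod_range_succ, ← Finset.prod_filter, ih,
      Finset.prod_range_succ, if_pos (by simp), if_neg (by simp [parity_simps]), mul_one]

theorem prod_filter_even {S : Type*} [CommMonoid S] (f : ℕ → S) (m : ℕ) :
    ∏ b ∈ (Finset.range (2 * m + 1)).filter (fun b => Even b), f b =
      (∏ i ∈ Finset.range m, f (2 * i + 2)) * f 0 := by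
  induction m with
  | zero => simp [Finset.filter_singleton]
  | succ m ih =>
    rw [show 2 * (m + 1) + 1 = 2 * m + 1 + 1 + 1 by ring, Finset.prod_filter,
      Finset.prod_range_succ, Finset.prod_range_succ, ← Finset.prod_filter, ih,
      Finset.prod_range_succ, if_neg (by simp), if_pos (by simp [parity_simps]), mul_one]
    rw [mul_right_comm]

/-- The weights of the letters: `2 i + 1` and `2 i + 2` have weights `q ^ (m - 1 - i)` and
`r q ^ (m - 1 - i)`, and `0` has weight `ρ q ^ m`. -/
def letterWeight (q r ρ : R) (m b : ℕ) : R :=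
  (if b = 0 then ρ else if Even b then r else 1) * q ^ (m - (b + 1) / 2)

theorem linProd_letterWeight_odd (q r ρ c : R) (m : ℕ) :
    linProd (letterWeight q r ρ m) (fun b => ¬ Even b) c (2 * m + 1) =
      ∏ i ∈ Finset.range m, (1 - PowerSeries.C (c * q ^ i) * PowerSeries.X) := by
  rw [linProd, prod_filter_odd, ← Finset.prod_range_reflect]
  refine Finset.prod_congr rfl fun i hi => ?_
  have := Finset.mem_range.1 hi
  rw [linFactor, letterWeight, if_neg (by omega), if_neg (by simp), one_mul,
    show m - (2 * (m - 1 - i) + 1 + 1) / 2 = i by omega]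

theorem linProd_letterWeight_even (q r ρ : R) (m : ℕ) :
    linProd (letterWeight q r ρ m) (fun b => Even b) 1 (2 * m + 1) =
      (∏ i ∈ Finset.range m, (1 - PowerSeries.C (r * q ^ i) * PowerSeries.X)) *
        (1 - PowerSeries.C (ρ * q ^ m) * PowerSeries.X) := by
  rw [linProd, prod_filter_even, ← Finset.prod_range_reflect]
  congr 1
  · refine Finset.prod_congr rfl fun i hi => ?_
    have := Finset.mem_range.1 hi
    rw [linFactor, letterWeight, if_neg (by omega), if_pos (by simp [parity_simps]), one_mul,
      show m - (2 * (m - 1 - i) + 2 + 1) / 2 = i by omega]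
  · simp [linFactor, letterWeight]

/-- Odd letters belong to moved points and even letters to fixed points. The letter 0 keeps a
separate parameter: ρ = r enlarges the alphabet of the fixed points by one letter, and ρ = 0 forbids
that letter. The condition on t permits cancelling 1 - t. -/
theorem diagSeries_letterWeight [IsDomain R] (q r ρ : R) {t : R} (ht : t ≠ 1) (m : ℕ) :
    diagSeries (Finset.range (2 * m + 1)) (letterWeight q r ρ m) 0 1
        (rowWords (fun b => Even b) t (2 * m + 1)) *
      (1 - PowerSeries.C (ρ * q ^ m) * PowerSeries.X) = hqSeries q r m * derSeries q t m := by
  have h := diagSeries_rowWords_mul_eq (fun b => Even b) t (letterWeight q r ρ m) (2 * m + 1)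
  rw [linProd_letterWeight_odd, linProd_letterWeight_odd, linProd_letterWeight_even] at h
  have h1 := hqSeries_mul_prod q 1 m
  have ht' := hqSeries_mul_prod q t m
  have hr := hqSeries_mul_prod q r m
  have hD := derDenom_mul_derSeries q t m
  have hQ := one_sub_mul_derDenom q t m
  have hne : (1 - PowerSeries.C t : PowerSeries R) ≠ 0 := by
    intro h0
    have := congrArg (PowerSeries.coeff 0) h0
    simp [sub_eq_zero] at this
    exact ht this.symm
  apply mul_left_cancel₀ hne
  generalize diagSeries (Finset.range (2 * m + 1)) (letterWeight q r ρ m) 0 1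
    (rowWords (fun b => Even b) t (2 * m + 1)) = Z at *
  generalize (1 - PowerSeries.C (ρ * q ^ m) * PowerSeries.X : PowerSeries R) = Y at *
  generalize (∏ i ∈ Finset.range m,
    (1 - PowerSeries.C (1 * q ^ i) * PowerSeries.X : PowerSeries R)) = E at *
  generalize (∏ i ∈ Finset.range m,
    (1 - PowerSeries.C (t * q ^ i) * PowerSeries.X : PowerSeries R)) = Et at *
  generalize (∏ i ∈ Finset.range m,
    (1 - PowerSeries.C (r * q ^ i) * PowerSeries.X : PowerSeries R)) = Er at *
  generalize hqSeries q 1 m = H at *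
  generalize hqSeries q t m = Ht at *
  generalize hqSeries q r m = Hr at *
  generalize derDenom q t m = Q at *
  generalize derSeries q t m = D at *
  generalize (PowerSeries.C t : PowerSeries R) = T at *
  have e1 : (1 - T) * (Z * Y) * Er * Q = 1 - T := by
    have e2 : Z * Y * Er * (Ht - T * H) = 1 - T := by
      linear_combination (H * Ht) * h + (1 - T - Z * Y * Er * Ht) * h1 +
        ((1 - T) * (H * E) + Z * Y * Er * T * H) * ht'
    linear_combination e2 + Z * Y * Er * hQ
  linear_combination (-(1 - T) * Z * Y) * hr - ((1 - T) * Z * Y * Hr * Er) * hD + (Hr * D) * e1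

end Specialization

/-! ### Weakly decreasing sequences with prescribed drops. -/

section AdmissibleSequences

/-- `γ` starts below `b`, and decreases by at least `e j` at the step to position `j`. -/
def Admissible {n : ℕ} (e : ℕ → ℕ) (b : ℕ) (γ : Fin n → ℕ) : Prop :=
  (∀ i : Fin n, (i : ℕ) = 0 → γ i + e i < b) ∧
    ∀ i j : Fin n, (i : ℕ) + 1 = j → γ j + e j ≤ γ i

theorem admissible_cons {n : ℕ} {e : ℕ → ℕ} {b x : ℕ} {γ : Fin n → ℕ} :
    Admissible e b (Fin.cons x γ : Fin (n + 1) → ℕ) ↔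
      x + e 0 < b ∧ Admissible (fun i => e (i + 1)) (x + 1) γ := by
  constructor
  · rintro ⟨h1, h2⟩
    refine ⟨by simpa using h1 0 rfl, fun i hi => ?_, fun i j hij => ?_⟩
    · have := h2 0 i.succ (by simp [hi])
      simp only [Fin.cons_succ, Fin.cons_zero, Fin.val_succ] at this
      exact Nat.lt_succ_of_le this
    · have := h2 i.succ j.succ (by simp [hij])
      simpa using this
  · rintro ⟨h1, h2, h3⟩
    refine ⟨fun i hi => ?_, fun i j hij => ?_⟩
    · have : i = 0 := Fin.ext hi
      subst this
      simpa using h1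
    · obtain ⟨j, rfl⟩ := Fin.exists_succ_eq.2 (show j ≠ 0 by rintro rfl; simp at hij)
      rw [Fin.val_succ, Nat.add_right_cancel_iff] at hij
      rw [Fin.cons_succ, Fin.val_succ]
      rcases Fin.eq_zero_or_eq_succ i with rfl | ⟨i, rfl⟩
      · exact Nat.lt_succ_iff.1 (h2 j hij.symm)
      · rw [Fin.cons_succ]
        exact h3 i j (by simpa using hij)

variable {R : Type*} [CommRing R] (q : R)

open Classical in
theorem sum_piFinset_cons {M : Type*} [AddCommMonoid M] (n : ℕ) (A : Finset ℕ)
    (f : (Fin (n + 1) → ℕ) → M) :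
    ∑ γ ∈ Fintype.piFinset (fun _ : Fin (n + 1) => A), f γ =
      ∑ x ∈ A, ∑ γ ∈ Fintype.piFinset (fun _ : Fin n => A), f (Fin.cons x γ) := by
  rw [← Finset.sum_product']
  refine Finset.sum_bij' (fun γ _ => (γ 0, Fin.tail γ)) (fun p _ => Fin.cons p.1 p.2)
    ?_ ?_ ?_ ?_ ?_
  · intro γ hγ
    rw [Fintype.mem_piFinset] at hγ
    rw [Finset.mem_product, Fintype.mem_piFinset]
    exact ⟨hγ 0, fun i => hγ i.succ⟩
  · intro p hp
    rw [Finset.mem_product, Fintype.mem_piFinset] at hp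
    rw [Fintype.mem_piFinset]
    intro i
    refine Fin.cases ?_ (fun i => ?_) i
    · simpa using hp.1
    · simpa using hp.2 i
  · intro γ _
    exact Fin.cons_self_tail γ
  · intro p _
    simp
  · intro γ _
    rw [Fin.cons_self_tail]

open Classical in
/-- The enumerator of the admissible sequences by their sum. -/
theorem sum_admissible {n : ℕ} (e : ℕ → ℕ) {b M : ℕ} (hb : b ≤ M) :
    ∑ γ ∈ Fintype.piFinset (fun _ : Fin n => Finset.range M) with Admissible e b γ,
      q ^ (∑ i, γ i) =
        q ^ (∑ i ∈ Finset.range n, i * e i) * hq q n (b - ∑ i ∈ Finset.range n, e i) := by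
  induction n generalizing e b with
  | zero =>
    have : ∀ γ : Fin 0 → ℕ, Admissible e b γ := fun γ => ⟨fun i => i.elim0, fun i => i.elim0⟩
    simp [this, hq_zero_left]
  | succ n ih =>
    rw [Finset.sum_filter, sum_piFinset_cons]
    have h1 : ∀ x ∈ Finset.range M,
        (∑ γ ∈ Fintype.piFinset (fun _ : Fin n => Finset.range M),
          if Admissible e b (Fin.cons x γ : Fin (n + 1) → ℕ) then
            q ^ (∑ i, (Fin.cons x γ : Fin (n + 1) → ℕ) i) else 0) =
        if x + e 0 < b then q ^ x * (q ^ (∑ i ∈ Finset.range n, i * e (i + 1)) *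
          hq q n (x + 1 - ∑ i ∈ Finset.range n, e (i + 1))) else 0 := by
      intro x hx
      simp only [admissible_cons]
      split_ifs with h
      · rw [← ih (fun i => e (i + 1)) (Finset.mem_range.1 hx), Finset.sum_filter, Finset.mul_sum]
        refine Finset.sum_congr rfl fun γ _ => ?_
        simp only [h, true_and, Fin.sum_univ_succ, Fin.cons_zero, Fin.cons_succ]
        split_ifs
        · rw [pow_add]
        · rw [mul_zero]
      · simp [h]
    rw [Finset.sum_congr rfl h1, ← Finset.sum_filter]
    have hfil : (Finset.range M).filter (fun x => x + e 0 < b) = Finset.range (b - e 0) := by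
      ext x; simp only [Finset.mem_filter, Finset.mem_range]; omega
    rw [hfil, Finset.sum_range_succ' (fun i => i * e i), Finset.sum_range_succ' e, zero_mul,
      add_zero]
    set s := ∑ i ∈ Finset.range n, e (i + 1) with hs
    have hw : ∑ i ∈ Finset.range n, (i + 1) * e (i + 1) =
        ∑ i ∈ Finset.range n, i * e (i + 1) + s := by
      rw [hs, ← Finset.sum_add_distrib]
      exact Finset.sum_congr rfl fun i _ => by ring
    rw [hw, hq_succ, show b - (s + e 0) = b - e 0 - s by omega]
    -- A first value below s leaves no room for the later drops. The truncated difference is then 0,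
    -- and h_n of the empty alphabet vanishes because x < s forces n ≠ 0.
    have hlow : ∀ x, x < s → hq q n (x + 1 - s) = 0 := by
      intro x hx
      rw [show x + 1 - s = 0 by omega]
      refine hq_zero_right q ?_
      rintro rfl
      simp [hs] at hx
    rcases le_or_gt s (b - e 0) with h | h
    · obtain ⟨k, hk⟩ := Nat.exists_eq_add_of_le h
      rw [hk, Finset.sum_range_add, Finset.sum_eq_zero, zero_add, Nat.add_sub_cancel_left,
        Finset.mul_sum]
      · refine Finset.sum_congr rfl fun x _ => ?_
        rw [show s + x + 1 - s = x + 1 by omega]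
        ring
      · intro x hx
        rw [hlow x (Finset.mem_range.1 hx)]
        ring
    · rw [Finset.sum_eq_zero, show b - e 0 - s = 0 by omega, Finset.sum_range_zero, mul_zero]
      intro x hx
      rw [hlow x ((Finset.mem_range.1 hx).trans h)]
      ring

theorem Admissible.le_of_le {n : ℕ} {e : ℕ → ℕ} {b : ℕ} {γ : Fin n → ℕ} (h : Admissible e b γ)
    {i j : Fin n} (hij : i ≤ j) : γ j ≤ γ i := by
  obtain ⟨j, hj⟩ := j
  induction j with
  | zero =>
    have : i = ⟨0, hj⟩ := Fin.ext (Nat.le_zero.1 hij)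
    rw [this]
  | succ j ih =>
    rcases Nat.of_le_succ (Fin.le_def.1 hij) with h1 | h1
    · exact (le_of_add_le_left (h.2 ⟨j, by omega⟩ ⟨j + 1, hj⟩ rfl)).trans (ih (by omega) h1)
    · rw [show i = ⟨j + 1, hj⟩ from Fin.ext h1]

end AdmissibleSequences

/-! ### Barred descents against descents and excedances. -/

section ShiftStatistics

variable {n : ℕ}

/-- The descent condition for the word `σ` whose excedances are barred, the barred values being
smaller than the others. -/
def BarredDescent (σ : Equiv.Perm (Fin n)) (i j : Fin n) : Prop :=
  (σ i ≤ i ∧ j < σ j) ∨ ((σ i ≤ i ↔ σ j ≤ j) ∧ σ j < σ i)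

open Classical in
/-- The least decrease of an admissible sequence at each position, with `ε` at position `0`. -/
noncomputable def shiftSeq (ε : ℕ) (σ : Equiv.Perm (Fin n)) : ℕ → ℕ
  | 0 => ε
  | i + 1 => if ∃ h : i + 1 < n, BarredDescent σ ⟨i, by omega⟩ ⟨i + 1, h⟩ then 1 else 0

open Classical in
/-- The indicator of `σ 0 ≠ 0`. -/
noncomputable def headMoved (σ : Equiv.Perm (Fin n)) : ℕ :=
  if ∃ h : 0 < n, σ ⟨0, h⟩ ≠ ⟨0, h⟩ then 1 else 0

open Classical in
theorem shiftSeq_of_succ_eq (ε : ℕ) (σ : Equiv.Perm (Fin n)) {i j : Fin n}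
    (hij : (i : ℕ) + 1 = j) : shiftSeq ε σ j = if BarredDescent σ i j then 1 else 0 := by
  obtain ⟨i, hi⟩ := i
  obtain ⟨j, hj⟩ := j
  simp only at hij
  subst hij
  simp [shiftSeq, hj]

/-- With x the excedance and d the descent indicator, shift(k+1) + x(k) = d(k) + x(k+1). Entering an
excedance from a non-excedance is a barred descent but not a descent, and leaving one is the
reverse; otherwise the two notions agree. Both sums then telescope. -/
theorem shift_sums_aux (σ : Equiv.Perm (Fin n)) (x d : ℕ → ℕ) (ε : ℕ)
    (hx : ∀ i : Fin n, x i = if i < σ i then 1 else 0)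
    (hd : ∀ i j : Fin n, (i : ℕ) + 1 = j → d i = if σ j < σ i then 1 else 0) (hε : ε = x 0)
    {k : ℕ} (hk : k < n) :
    ∑ i ∈ Finset.range (k + 1), shiftSeq ε σ i = ∑ i ∈ Finset.range k, d i + x k ∧
      ∑ i ∈ Finset.range (k + 1), i * shiftSeq ε σ i + ∑ i ∈ Finset.range (k + 1), x i =
        ∑ i ∈ Finset.range k, (i + 1) * d i + (k + 1) * x k := by
  classical
  induction k with
  | zero => simp [shiftSeq, hε]
  | succ k ih =>
    obtain ⟨ih1, ih2⟩ := ih (by omega)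
    have hstep : shiftSeq ε σ (k + 1) + x k = d k + x (k + 1) := by
      have hij : ((⟨k, by omega⟩ : Fin n) : ℕ) + 1 = (⟨k + 1, hk⟩ : Fin n) := rfl
      have h1 := shiftSeq_of_succ_eq ε σ hij
      have h2 := hx ⟨k, by omega⟩
      have h3 := hx ⟨k + 1, hk⟩
      have h4 := hd _ _ hij
      have hlt : (⟨k, by omega⟩ : Fin n) < ⟨k + 1, hk⟩ := Fin.lt_def.2 (Nat.lt_succ_self k)
      generalize (⟨k, by omega⟩ : Fin n) = i at *
      have hij' : (i : ℕ) + 1 = k + 1 := hij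
      generalize hj : (⟨k + 1, hk⟩ : Fin n) = j at *
      have hjk : (j : ℕ) = k + 1 := by rw [← hj]
      have hik : (i : ℕ) = k := by omega
      have hinj : (σ i : ℕ) ≠ σ j := fun h => hlt.ne (σ.injective (Fin.ext h))
      rw [hjk] at h1 h3
      rw [hik] at h2 h4
      rw [h1, h2, h3, h4, BarredDescent]
      simp only [Fin.lt_def, Fin.le_def]
      split_ifs <;> omega
    constructor
    · rw [Finset.sum_range_succ, ih1, Finset.sum_range_succ d]
      omega
    · rw [Finset.sum_range_succ, Finset.sum_range_succ x, Finset.sum_range_succ (fun i => _ * d i)]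
      nlinarith [hstep]

/-- The boundary terms disappear: the last position is never an excedance, and the first is one
exactly when it is moved, which is what `headMoved` records. -/
theorem shift_sums (σ : Equiv.Perm (Fin n)) :
    ∑ i ∈ Finset.range n, shiftSeq (headMoved σ) σ i = desNumber σ ∧
      ∑ i ∈ Finset.range n, i * shiftSeq (headMoved σ) σ i + excNumber σ = majIndex σ := by
  classical
  rcases Nat.eq_zero_or_pos n with rfl | hn
  · simp [desNumber, excNumber, majIndex, Finset.eq_empty_of_isEmpty]
  set x : ℕ → ℕ := fun i => if h : i < n then if (⟨i, h⟩ : Fin n) < σ ⟨i, h⟩ then 1 else 0 else 0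
    with hxd
  set d : ℕ → ℕ := fun i => if h : i < n then if (⟨i, h⟩ : Fin n) ∈ descentSet σ then 1 else 0
    else 0 with hdd
  have hx : ∀ i : Fin n, x i = if i < σ i then 1 else 0 := fun i => by simp [hxd]
  have hd' : ∀ i : Fin n, d i = if i ∈ descentSet σ then 1 else 0 := fun i => by simp [hdd]
  have hd : ∀ i j : Fin n, (i : ℕ) + 1 = j → d i = if σ j < σ i then 1 else 0 := by
    intro i j hij
    have : j = ⟨(i : ℕ) + 1, hij ▸ j.2⟩ := Fin.ext hij.symm
    rw [hd']
    congr 1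
    rw [descentSet, Finset.mem_filter, eq_iff_iff, this]
    simp only [Finset.mem_univ, true_and]
    exact ⟨fun ⟨_, h⟩ => h, fun h => ⟨_, h⟩⟩
  have hε : headMoved σ = x 0 := by
    rw [hx ⟨0, hn⟩, headMoved]
    congr 1
    rw [eq_iff_iff]
    constructor
    · rintro ⟨_, h⟩
      rw [Fin.lt_def]
      have : (σ ⟨0, hn⟩ : ℕ) ≠ 0 := fun h0 => h (Fin.ext h0)
      exact Nat.pos_of_ne_zero this
    · exact fun h => ⟨hn, h.ne'⟩
  obtain ⟨k, rfl⟩ : ∃ k, n = k + 1 := ⟨n - 1, by omega⟩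
  obtain ⟨h1, h2⟩ := shift_sums_aux σ x d (headMoved σ) hx hd hε (Nat.lt_succ_self k)
  have hxk : x k = 0 := by
    have := hx (Fin.last k)
    rw [Fin.val_last] at this
    rw [this, if_neg (not_lt.2 (Fin.le_last _))]
  have hdk : d k = 0 := by
    have := hd' (Fin.last k)
    rw [Fin.val_last] at this
    rw [this, if_neg]
    simp [descentSet]
  have e1 : ∑ i ∈ Finset.range k, d i = desNumber σ := by
    have : ∑ i ∈ Finset.range (k + 1), d i = desNumber σ := by
      rw [Finset.sum_range, desNumber]
      simp only [hd']
      rw [← Finset.card_filter, Finset.filter_univ_mem]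
    rw [← this, Finset.sum_range_succ, hdk, add_zero]
  have e2 : ∑ i ∈ Finset.range k, (i + 1) * d i = majIndex σ := by
    have : ∑ i ∈ Finset.range (k + 1), (i + 1) * d i = majIndex σ := by
      rw [Finset.sum_range, majIndex]
      simp only [hd', mul_ite, mul_one, mul_zero]
      rw [← Finset.sum_filter, Finset.filter_univ_mem]
    rw [← this, Finset.sum_range_succ, hdk, mul_zero, add_zero]
  have e3 : ∑ i ∈ Finset.range (k + 1), x i = excNumber σ := by
    rw [Finset.sum_range, excNumber, Finset.card_filter]
    exact Finset.sum_congr rfl fun i _ => hx i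
  rw [hxk, add_zero] at h1
  rw [hxk, mul_zero, add_zero, e3, e2] at h2
  exact ⟨h1.trans e1, h2⟩

end ShiftStatistics

/-! ### Colourings of a fixed permutation, and the two generating functions. -/

section ColouringsOfPermutations

variable {n : ℕ}

theorem strictMono_fin_iff {α : Type*} [Preorder α] (f : Fin n → α) :
    StrictMono f ↔ ∀ i j : Fin n, (i : ℕ) + 1 = j → f i < f j := by
  constructor
  · intro h i j hij
    exact h (Fin.lt_def.2 (by omega))
  · intro h
    cases n with
    | zero => exact fun i => i.elim0
    | succ n =>
      rw [Fin.strictMono_iff_lt_succ]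
      exact fun i => h _ _ (by simp)

theorem strictMono_toLex_iff {α β : Type*} [LinearOrder α] [LinearOrder β] (f : Fin n → α)
    (g : Fin n → β) : StrictMono (fun i => toLex (f i, g i)) ↔
      Monotone f ∧ ∀ i j, i < j → f i = f j → g i < g j := by
  constructor
  · intro h
    refine ⟨fun i j hij => Prod.Lex.monotone_fst _ _ (h.monotone hij), fun i j hij he => ?_⟩
    have := h hij
    rw [Prod.Lex.lt_iff] at this
    rcases this with h1 | h1
    · exact absurd he h1.ne
    · exact h1.2
  · rintro ⟨h1, h2⟩ i j hij
    rw [Prod.Lex.lt_iff]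
    rcases (h1 hij.le).lt_or_eq with h3 | h3
    · exact Or.inl h3
    · exact Or.inr ⟨h3, h2 i j hij h3⟩

/-- The first two conditions of compatibility say that (flagged letter, value of σ) increases
strictly in the lexicographic order, so consecutive positions suffice. -/
theorem compatible_iff (φ : ℕ → Prop) (c : Fin n → ℕ) (σ : Equiv.Perm (Fin n)) :
    Compatible φ c σ ↔ (∀ i j : Fin n, (i : ℕ) + 1 = j →
      c i < c j ∨ (c i = c j ∧ ¬ BarredDescent σ i j)) ∧ ∀ i, φ (c i) ↔ σ i = i := by
  rw [Compatible, ← and_assoc, ← strictMono_toLex_iff, strictMono_fin_iff]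
  refine and_congr_left' (forall₃_congr fun i j hij => ?_)
  have hinj : (σ i : ℕ) ≠ σ j := fun h => by
    have := σ.injective (Fin.ext h)
    rw [this] at hij
    omega
  simp only [flagged, Prod.Lex.lt_iff, ofLex_toLex, BarredDescent, toLex_inj, Prod.mk.injEq,
    Bool.lt_iff, decide_eq_true_eq, decide_eq_false_iff_not, decide_eq_decide, Fin.lt_def,
    Fin.le_def]
  omega

/-- The colouring with `2 (m - γ i)` at the fixed points and `2 (m - γ i) - 1` elsewhere. -/
def colouring (m : ℕ) (σ : Equiv.Perm (Fin n)) (γ : Fin n → ℕ) (i : Fin n) : ℕ :=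
  2 * (m - γ i) - if σ i = i then 0 else 1

/-- For a moved point with γ i = m the truncated 2 (m - γ i) - 1 would be 0, the letter of a fixed
point. This cannot happen: a moved first point forces a drop at once, and a moved point following a
fixed one is always a barred descent. -/
theorem Admissible.lt_of_moved {m : ℕ} {σ : Equiv.Perm (Fin n)} {γ : Fin n → ℕ}
    (h : Admissible (shiftSeq (headMoved σ) σ) (m + 1) γ) (hγ : ∀ i, γ i ≤ m) (i : Fin n)
    (hi : σ i ≠ i) : γ i < m := by
  classical
  obtain ⟨i, hin⟩ := i
  induction i with
  | zero =>
    have h1 := h.1 ⟨0, hin⟩ rfl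
    rw [show shiftSeq (headMoved σ) σ ((⟨0, hin⟩ : Fin n) : ℕ) = 1 from if_pos ⟨hin, hi⟩] at h1
    omega
  | succ i ih =>
    have hij : ((⟨i, by omega⟩ : Fin n) : ℕ) + 1 = (⟨i + 1, hin⟩ : Fin n) := rfl
    have h2 := h.2 _ _ hij
    rw [shiftSeq_of_succ_eq _ _ hij] at h2
    specialize ih (by omega)
    have h3 := hγ ⟨i, by omega⟩
    have h4 := hγ ⟨i + 1, hin⟩
    generalize (⟨i + 1, hin⟩ : Fin n) = j at *
    generalize (⟨i, by omega⟩ : Fin n) = k at *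
    by_contra hj
    have hk : σ k = k := by
      by_contra hk
      have := ih hk
      omega
    rw [if_pos] at h2
    · omega
    · have hne : σ j ≠ σ k := fun h => by
        have := σ.injective h
        rw [this] at hij
        omega
      simp only [BarredDescent, hk] at *
      simp only [ne_eq, Fin.ext_iff, Fin.lt_def, Fin.le_def] at *
      omega

-- The parity of a colour is dictated by σ, so only γ is free. At equal γ the colour falls exactly
-- from a fixed to a moved point, where a drop of γ is forced anyway.
open Classical in
theorem sum_compatible_eq_sum_admissible {M : Type*} [AddCommMonoid M] (m : ℕ)
    (σ : Equiv.Perm (Fin n)) (f : (Fin n → ℕ) → M) :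
    ∑ c ∈ Fintype.piFinset (fun _ : Fin n => Finset.range (2 * m + 1)) with
        Compatible (fun b => Even b) c σ, f c =
      ∑ γ ∈ Fintype.piFinset (fun _ : Fin n => Finset.range (m + 1)) with
        Admissible (shiftSeq (headMoved σ) σ) (m + 1) γ, f (colouring m σ γ) := by
  symm
  refine Finset.sum_bij' (fun γ _ => colouring m σ γ) (fun c _ i => m - (c i + 1) / 2)
    ?_ ?_ ?_ ?_ (fun _ _ => rfl)
  · intro γ hγ
    rw [Finset.mem_filter, Fintype.mem_piFinset] at hγ ⊢
    obtain ⟨h1, h2⟩ := hγ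
    have hm : ∀ i, γ i ≤ m := fun i => Nat.lt_succ_iff.1 (Finset.mem_range.1 (h1 i))
    have hmv := h2.lt_of_moved hm
    refine ⟨fun i => ?_, (compatible_iff _ _ _).2 ⟨fun i j hij => ?_, fun i => ?_⟩⟩
    · rw [Finset.mem_range, colouring]; omega
    · have h3 := h2.2 i j hij
      rw [shiftSeq_of_succ_eq _ _ hij] at h3
      have hi := hm i
      have hj := hm j
      have hmi := hmv i
      have hmj := hmv j
      have hne : σ j ≠ σ i := fun h => by
        have := σ.injective h
        rw [this] at hij
        omega
      simp only [BarredDescent, colouring, ne_eq, Fin.ext_iff, Fin.lt_def, Fin.le_def] at *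
      split_ifs at * <;> omega
    · have hmi := hmv i
      rw [colouring, Nat.even_iff]
      split_ifs with h <;> simp only [h, not_false_eq_true, ne_eq, true_imp_iff, iff_true,
        iff_false] at * <;> omega
  · intro c hc
    rw [Finset.mem_filter, Fintype.mem_piFinset] at hc ⊢
    obtain ⟨h1, h2⟩ := hc
    rw [compatible_iff] at h2
    obtain ⟨h2, h3⟩ := h2
    have hN : ∀ i, c i < 2 * m + 1 := fun i => Finset.mem_range.1 (h1 i)
    refine ⟨fun i => ?_, fun i hi => ?_, fun i j hij => ?_⟩
    · rw [Finset.mem_range]; omega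
    · have h0 := h3 i
      have hc := hN i
      have : shiftSeq (headMoved σ) σ i = if σ i ≠ i then 1 else 0 := by
        obtain ⟨i, hin⟩ := i
        simp only at hi
        subst hi
        simp [shiftSeq, headMoved, hin]
      rw [this]
      change m - (c i + 1) / 2 + _ < m + 1
      rw [Nat.even_iff] at h0
      by_cases h : σ i = i
      · rw [if_neg (not_not.2 h)]; omega
      · rw [if_pos h]
        have := mt h0.1 h
        omega
    · have h4 := h2 i j hij
      have hi := hN i
      have hj := hN j
      have h5 := h3 i
      have h6 := h3 j
      have hne : σ j ≠ σ i := fun h => by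
        have := σ.injective h
        rw [this] at hij
        omega
      rw [shiftSeq_of_succ_eq _ _ hij]
      simp only [BarredDescent, ne_eq, Fin.ext_iff, Fin.lt_def, Fin.le_def, Nat.even_iff] at *
      split_ifs <;> omega
  · intro γ hγ
    rw [Finset.mem_filter, Fintype.mem_piFinset] at hγ
    obtain ⟨h1, h2⟩ := hγ
    have hm : ∀ i, γ i ≤ m := fun i => Nat.lt_succ_iff.1 (Finset.mem_range.1 (h1 i))
    funext i
    have hmv := h2.lt_of_moved hm i
    have := hm i
    simp only [colouring]
    split_ifs with h <;> simp only [h, not_false_eq_true, ne_eq, true_imp_iff] at * <;> omega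
  · intro c hc
    rw [Finset.mem_filter, Fintype.mem_piFinset] at hc
    obtain ⟨h1, h2⟩ := hc
    rw [compatible_iff] at h2
    funext i
    have hN := Finset.mem_range.1 (h1 i)
    have h3 := h2.2 i
    rw [Nat.even_iff] at h3
    simp only [colouring]
    split_ifs with h <;> simp only [h, iff_true, iff_false] at h3 <;> omega

variable {R : Type*} [CommRing R] (q : R)

theorem pow_fixNumber (r : R) (σ : Equiv.Perm (Fin n)) :
    ∏ i, (if σ i = i then r else 1) = r ^ fixNumber σ := by
  rw [fixNumber, ← Finset.prod_const, Finset.prod_filter]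

theorem prod_letterWeight_colouring {m : ℕ} {σ : Equiv.Perm (Fin n)} {γ : Fin n → ℕ} (r : R)
    (hm : ∀ i, γ i ≤ m) (hmv : ∀ i, σ i ≠ i → γ i < m) :
    ∏ i, letterWeight q r r m (colouring m σ γ i) = r ^ fixNumber σ * q ^ (∑ i, γ i) := by
  rw [← pow_fixNumber, ← Finset.prod_pow_eq_pow_sum, ← Finset.prod_mul_distrib]
  refine Finset.prod_congr rfl fun i _ => ?_
  have h1 := hm i
  have h2 := hmv i
  rw [letterWeight]
  by_cases h : σ i = i
  · have hc : colouring m σ γ i = 2 * (m - γ i) := by rw [colouring, if_pos h, Nat.sub_zero]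
    have he : Even (colouring m σ γ i) := by rw [hc]; exact even_two_mul _
    rw [if_pos he, ite_self, if_pos h, hc]
    congr 2
    omega
  · have hlt := h2 h
    have hc : colouring m σ γ i = 2 * (m - γ i) - 1 := by rw [colouring, if_neg h]
    have he : ¬ Even (colouring m σ γ i) := by rw [hc, Nat.even_iff]; omega
    rw [if_neg he, if_neg (by omega), if_neg h, hc]
    congr 2
    omega

/-- The value m is attained only at fixed points and yields the letter 0, whose weight is zero here.
-/
theorem prod_letterWeight_colouring_zero {m : ℕ} {σ : Equiv.Perm (Fin n)} {γ : Fin n → ℕ}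
    (hmv : ∀ i, σ i ≠ i → γ i < m) :
    ∏ i, letterWeight q 1 0 m (colouring m σ γ i) =
      if ∀ i, γ i < m then q ^ (∑ i, γ i) else 0 := by
  split_ifs with hall
  · rw [← Finset.prod_pow_eq_pow_sum]
    refine Finset.prod_congr rfl fun i _ => ?_
    have h1 := hall i
    rw [letterWeight, ite_self, colouring]
    split_ifs
    · omega
    · rw [one_mul]; congr 1; omega
    · omega
    · rw [one_mul]; congr 1; omega
  · push Not at hall
    obtain ⟨i, hi⟩ := hall
    refine Finset.prod_eq_zero (Finset.mem_univ i) ?_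
    have h : σ i = i := by
      by_contra h
      exact absurd (hmv i h) (not_lt.2 hi)
    rw [letterWeight, if_pos, zero_mul]
    rw [colouring, if_pos h]
    omega

/-- An admissible sequence decreases weakly, so staying below m is a condition on its first entry: a
drop of one at position 0. -/
theorem admissible_shiftSeq_one {m : ℕ} {σ : Equiv.Perm (Fin n)} {γ : Fin n → ℕ} :
    (Admissible (shiftSeq (headMoved σ) σ) (m + 1) γ ∧ ∀ i, γ i < m) ↔
      Admissible (shiftSeq 1 σ) (m + 1) γ := by
  classical
  have hs : ∀ i j : Fin n, (i : ℕ) + 1 = j →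
      shiftSeq (headMoved σ) σ j = shiftSeq 1 σ j := by
    intro i j hij
    rw [shiftSeq_of_succ_eq _ _ hij, shiftSeq_of_succ_eq _ _ hij]
  constructor
  · rintro ⟨⟨-, h2⟩, h3⟩
    refine ⟨fun i hi => ?_, fun i j hij => ?_⟩
    · rw [hi, shiftSeq]
      exact Nat.succ_lt_succ (h3 i)
    · rw [← hs i j hij]
      exact h2 i j hij
  · intro h
    refine ⟨⟨fun i hi => ?_, fun i j hij => ?_⟩, fun i => ?_⟩
    · have h1 := h.1 i hi
      rw [hi, shiftSeq] at h1 ⊢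
      have : headMoved σ ≤ 1 := by rw [headMoved]; split_ifs <;> simp
      omega
    · rw [hs i j hij]
      exact h.2 i j hij
    · have h1 := h.1 ⟨0, i.pos⟩ rfl
      have h2 := h.le_of_le (Fin.mk_le_of_le_val (Nat.zero_le (i : ℕ)) :
        (⟨0, i.pos⟩ : Fin n) ≤ i)
      rw [shiftSeq] at h1
      omega

/-- Position 0 has weight 0 in this sum, so the drop there can be altered without changing maj -
exc. -/
theorem sum_mul_shiftSeq (ε : ℕ) (σ : Equiv.Perm (Fin n)) :
    ∑ i ∈ Finset.range n, i * shiftSeq ε σ i = majIndex σ - excNumber σ := by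
  rw [← (shift_sums σ).2, Nat.add_sub_cancel]
  refine Finset.sum_congr rfl fun i _ => ?_
  cases i with
  | zero => rw [zero_mul, zero_mul]
  | succ i => rfl

/-- The generating function of `(maj - exc, des, exc, fix)`. -/
theorem sum_perm_eq_coeff [IsDomain R] {t : R} (ht : t ≠ 1) (r : R) (m : ℕ) :
    ∑ σ : Equiv.Perm (Fin n), t ^ excNumber σ * (r ^ fixNumber σ *
        (q ^ (majIndex σ - excNumber σ) * hq q n (m + 1 - desNumber σ))) =
      PowerSeries.coeff n (hqSeries q r (m + 1) * derSeries q t m) := by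
  classical
  have hZ := diagSeries_letterWeight q r r ht m
  -- Trade the m-letter series for the one with m + 1 letters, so that 1 - r q^m z appears on both
  -- sides and cancels.
  rw [← hqSeries_succ, mul_right_comm] at hZ
  have hne : (1 - PowerSeries.C (r * q ^ m) * PowerSeries.X : PowerSeries R) ≠ 0 := by
    intro h0
    simpa using congrArg (PowerSeries.coeff 0) h0
  rw [← mul_right_cancel₀ hne hZ, ← sum_compatible_eq_diagSeries]
  refine Finset.sum_congr rfl fun σ _ => ?_
  rw [sum_compatible_eq_sum_admissible, ← sum_mul_shiftSeq (headMoved σ), ← (shift_sums σ).1,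
    ← sum_admissible q _ le_rfl, Finset.mul_sum]
  congr 1
  refine Finset.sum_congr rfl fun γ hγ => ?_
  rw [Finset.mem_filter, Fintype.mem_piFinset] at hγ
  have hm : ∀ i, γ i ≤ m := fun i => Nat.lt_succ_iff.1 (Finset.mem_range.1 (hγ.1 i))
  rw [prod_letterWeight_colouring q r hm (hγ.2.lt_of_moved hm)]

/-- The generating function of the stable statistics, in which a descent is always counted at
position `0`. -/
theorem sum_perm_eq_coeff_shiftSeq_one [IsDomain R] {t : R} (ht : t ≠ 1) (m : ℕ) :
    ∑ σ : Equiv.Perm (Fin n), t ^ excNumber σ * (q ^ (majIndex σ - excNumber σ) *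
        hq q n (m + 1 - ∑ i ∈ Finset.range n, shiftSeq 1 σ i)) =
      PowerSeries.coeff n (hqSeries q 1 m * derSeries q t m) := by
  classical
  have hZ := diagSeries_letterWeight q 1 0 ht m
  rw [zero_mul, map_zero, zero_mul, sub_zero, mul_one] at hZ
  rw [← hZ, ← sum_compatible_eq_diagSeries]
  refine Finset.sum_congr rfl fun σ _ => ?_
  rw [sum_compatible_eq_sum_admissible, ← sum_mul_shiftSeq 1, ← sum_admissible q _ le_rfl]
  congr 1
  simp only [← admissible_shiftSeq_one]
  rw [← Finset.filter_filter, Finset.sum_filter]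
  refine Finset.sum_congr rfl fun γ hγ => ?_
  rw [Finset.mem_filter, Fintype.mem_piFinset] at hγ
  have hm : ∀ i, γ i ≤ m := fun i => Nat.lt_succ_iff.1 (Finset.mem_range.1 (hγ.1 i))
  rw [prod_letterWeight_colouring_zero q (hγ.2.lt_of_moved hm)]

end ColouringsOfPermutations

/-! ### Products of complete homogeneous polynomials as enumerators of words. -/

section BlockWords

variable {n : ℕ}

/-- The word `u` is weakly decreasing at the positions in `I`, and its letters outside the last
`k` positions are below `m`. -/
def BlockWord (I : Set ℕ) (k m : ℕ) (u : Fin n → ℕ) : Prop :=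
  (∀ i j : Fin n, (i : ℕ) + 1 = j → (i : ℕ) ∈ I → u j ≤ u i) ∧
    ∀ j : Fin n, (j : ℕ) + k < n → u j < m

variable {R : Type*} [CommRing R] (q : R)

open Classical in
/-- The enumerator by their sum of the block words with letters at most `m`. -/
noncomputable def blockWordSum (n : ℕ) (I : Set ℕ) (k m : ℕ) : R :=
  ∑ u ∈ Fintype.piFinset (fun _ : Fin n => Finset.range (m + 1)) with BlockWord I k m u,
    q ^ (∑ i, u i)

open Classical in
/-- The indicators of the descents of `π`, with position `0` counted if `π 0` is not among the
last `k` values. -/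
noncomputable def blockShift (k : ℕ) (π : Equiv.Perm (Fin n)) : ℕ → ℕ
  | 0 => if ∃ h : 0 < n, (π ⟨0, h⟩ : ℕ) + k < n then 1 else 0
  | i + 1 => if ∃ h : i + 1 < n, π ⟨i + 1, h⟩ < π ⟨i, by omega⟩ then 1 else 0

theorem blockShift_le_one (k : ℕ) (π : Equiv.Perm (Fin n)) (i : ℕ) : blockShift k π i ≤ 1 := by
  cases i <;> rw [blockShift] <;> split_ifs <;> simp

theorem blockShift_of_eq_zero (k : ℕ) (π : Equiv.Perm (Fin n)) {i : Fin n} (hi : (i : ℕ) = 0) :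
    blockShift k π i = if (π i : ℕ) + k < n then 1 else 0 := by
  obtain ⟨i, hin⟩ := i
  simp only at hi
  subst hi
  simp [blockShift, hin]

theorem blockShift_of_succ_eq (k : ℕ) (π : Equiv.Perm (Fin n)) {i j : Fin n}
    (hij : (i : ℕ) + 1 = j) : blockShift k π j = if π j < π i then 1 else 0 := by
  obtain ⟨i, hi⟩ := i
  obtain ⟨j, hj⟩ := j
  simp only at hij
  subst hij
  simp [blockShift, hj]

/-- The inverse of `π` increases at the positions in `I`. -/
def InverseIncreasing (I : Set ℕ) (π : Equiv.Perm (Fin n)) : Prop :=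
  ∀ i j : Fin n, (i : ℕ) + 1 = j → (i : ℕ) ∈ I → π.symm i < π.symm j

/-- Stable sorting into decreasing order: equal letters must be read from left to right, so the
sorted word drops strictly at the descents of π. -/
theorem sort_toDual_eq_iff (k : ℕ) (u : Fin n → ℕ) (π : Equiv.Perm (Fin n)) :
    Tuple.sort (fun i => OrderDual.toDual (u i)) = π ↔
      ∀ i j : Fin n, (i : ℕ) + 1 = j → u (π j) + blockShift k π j ≤ u (π i) := by
  rw [eq_comm, Tuple.eq_sort_iff]
  refine (strictMono_toLex_iff ((fun i => OrderDual.toDual (u i)) ∘ π)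
    (fun i => π i)).symm.trans ?_
  rw [strictMono_fin_iff]
  refine forall₃_congr fun i j hij => ?_
  rw [blockShift_of_succ_eq k π hij, Prod.Lex.lt_iff]
  have hne : π i ≠ π j := fun h => by
    have := π.injective h
    rw [this] at hij
    omega
  simp only [ofLex_toLex, Function.comp_apply, OrderDual.toDual_lt_toDual, OrderDual.toDual_inj]
  rcases lt_or_gt_of_ne hne with h | h
  · rw [if_neg h.not_gt]; simp only [h, and_true]; omega
  · rw [if_pos h]; simp only [h.not_gt, and_false, or_false]; omega

/-- A weak descent of u at i, i + 1 means that the stable sort lists i before i + 1. The bound on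
the letters needs testing only at π 0, the leftmost place of the largest letter: if that place is
among the last k, so is every other place with the same letter. -/
theorem blockWord_and_sort_eq_iff (I : Set ℕ) {k m : ℕ} {u : Fin n → ℕ} (hu : ∀ i, u i ≤ m)
    (π : Equiv.Perm (Fin n)) :
    (BlockWord I k m u ∧ Tuple.sort (fun i => OrderDual.toDual (u i)) = π) ↔
      InverseIncreasing I π ∧ Admissible (blockShift k π) (m + 1) (u ∘ π) := by
  have hadj := sort_toDual_eq_iff k u π
  have hmain : Tuple.sort (fun i => OrderDual.toDual (u i)) = π →
      (BlockWord I k m u ↔ InverseIncreasing I π ∧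
        ∀ i : Fin n, (i : ℕ) = 0 → (u ∘ π) i + blockShift k π i < m + 1) := by
    intro h
    obtain ⟨hmono, hties⟩ := Tuple.eq_sort_iff.1 h.symm
    have hanti : ∀ i j, i ≤ j → u (π j) ≤ u (π i) := fun i j hij => hmono hij
    have hties' : ∀ i j, i < j → u (π i) = u (π j) → π i < π j := fun i j hij he =>
      hties i j hij (congrArg OrderDual.toDual he)
    refine and_congr (forall₄_congr fun i j hij _ => ?_) ⟨fun h1 i hi => ?_, fun h1 j hj => ?_⟩
    · have hlt : i < j := Fin.lt_def.2 (by omega)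
      constructor
      · intro h1
        by_contra h2
        have hne : π.symm i ≠ π.symm j := fun h => hlt.ne (π.symm.injective h)
        have h3 : π.symm j < π.symm i := lt_of_le_of_ne (not_lt.1 h2) hne.symm
        have h4 := hanti _ _ h3.le
        rw [Equiv.apply_symm_apply, Equiv.apply_symm_apply] at h4
        have h5 := hties' _ _ h3
        rw [Equiv.apply_symm_apply, Equiv.apply_symm_apply] at h5
        exact absurd (h5 (le_antisymm h1 h4)) hlt.not_gt
      · intro h1
        have h4 := hanti _ _ h1.le
        rwa [Equiv.apply_symm_apply, Equiv.apply_symm_apply] at h4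
    · rw [blockShift_of_eq_zero k π hi, Function.comp_apply]
      have := hu (π i)
      split_ifs with h2
      · have := h1 (π i) h2
        omega
      · omega
    · set z : Fin n := ⟨0, j.pos⟩ with hz
      have h2 := h1 z rfl
      rw [blockShift_of_eq_zero k π rfl, Function.comp_apply] at h2
      have hzle : z ≤ π.symm j := Fin.mk_le_of_le_val (Nat.zero_le _)
      have h3 := hanti z (π.symm j) hzle
      rw [Equiv.apply_symm_apply] at h3
      split_ifs at h2 with h4
      · omega
      · by_contra h5
        have h6 : u (π z) = u j := by omega
        -- Here u j equals the largest letter m, and the sort would list j after the first place π z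
        -- although j lies to its left.
        have hlt : z < π.symm j := by
          refine lt_of_le_of_ne hzle fun he => h4 ?_
          rw [he, Equiv.apply_symm_apply]
          exact hj
        have h7 := hties' _ _ hlt (by rwa [Equiv.apply_symm_apply])
        rw [Equiv.apply_symm_apply, Fin.lt_def] at h7
        omega
  constructor
  · rintro ⟨h1, h2⟩
    obtain ⟨h3, h4⟩ := (hmain h2).1 h1
    exact ⟨h3, h4, hadj.1 h2⟩
  · rintro ⟨h1, h2, h3⟩
    have h4 := hadj.2 h3
    exact ⟨(hmain h4).2 ⟨h1, h2⟩, h4⟩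

open Classical in
/-- Standardization expands the enumerator of block words. -/
theorem blockWordSum_eq (I : Set ℕ) (k m : ℕ) :
    blockWordSum q n I k m = ∑ π : Equiv.Perm (Fin n) with InverseIncreasing I π,
      q ^ (∑ i ∈ Finset.range n, i * blockShift k π i) *
        hq q n (m + 1 - ∑ i ∈ Finset.range n, blockShift k π i) := by
  rw [blockWordSum, ← Finset.sum_fiberwise _
    (fun u : Fin n → ℕ => Tuple.sort fun i => OrderDual.toDual (u i)), Finset.sum_filter]
  refine Finset.sum_congr rfl fun π _ => ?_
  rw [Finset.filter_filter]
  have hmem : ∀ u : Fin n → ℕ,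
      u ∈ Fintype.piFinset (fun _ : Fin n => Finset.range (m + 1)) ↔ ∀ i, u i ≤ m := by
    intro u
    simp
  split_ifs with h
  · rw [← sum_admissible q _ le_rfl]
    refine Finset.sum_bij' (fun u _ => u ∘ π) (fun γ _ => γ ∘ π.symm) ?_ ?_ ?_ ?_ ?_
    · intro u hu
      rw [Finset.mem_filter, hmem] at hu ⊢
      exact ⟨fun i => hu.1 _, ((blockWord_and_sort_eq_iff I hu.1 π).1 hu.2).2⟩
    · intro γ hγ
      rw [Finset.mem_filter, hmem] at hγ ⊢
      have h1 : ∀ i, (γ ∘ π.symm) i ≤ m := fun i => hγ.1 _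
      refine ⟨h1, (blockWord_and_sort_eq_iff I h1 π).2 ⟨h, ?_⟩⟩
      rw [Function.comp_assoc, Equiv.symm_comp_self, Function.comp_id]
      exact hγ.2
    · intro u _
      rw [Function.comp_assoc, Equiv.self_comp_symm, Function.comp_id]
    · intro γ _
      rw [Function.comp_assoc, Equiv.symm_comp_self, Function.comp_id]
    · intro u _
      rw [← Equiv.sum_comp π u]
      rfl
  · refine Finset.sum_eq_zero fun u hu => ?_
    rw [Finset.mem_filter, hmem] at hu
    exact absurd ((blockWord_and_sort_eq_iff I hu.1 π).1 hu.2).1 h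

theorem sum_blockShift_le (k : ℕ) (π : Equiv.Perm (Fin n)) :
    ∑ i ∈ Finset.range n, blockShift k π i ≤ n := by
  refine (Finset.sum_le_card_nsmul _ _ 1 fun i _ => blockShift_le_one k π i).trans ?_
  simp

open Classical in
theorem hq_eq_sum {b M : ℕ} (hb : b ≤ M) (n : ℕ) :
    hq q n b = ∑ γ ∈ Fintype.piFinset (fun _ : Fin n => Finset.range M) with
      Admissible (fun _ => 0) b γ, q ^ (∑ i, γ i) := by
  rw [sum_admissible q _ hb]
  simp

theorem admissible_zero_iff {b : ℕ} {γ : Fin n → ℕ} :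
    Admissible (fun _ => 0) b γ ↔
      (∀ i j : Fin n, (i : ℕ) + 1 = j → γ j ≤ γ i) ∧ ∀ i, γ i < b := by
  constructor
  · intro h
    refine ⟨fun i j hij => h.2 i j hij, fun i => ?_⟩
    have h1 := h.1 ⟨0, i.pos⟩ rfl
    have h2 := h.le_of_le (Fin.mk_le_of_le_val (Nat.zero_le (i : ℕ)) :
      (⟨0, i.pos⟩ : Fin n) ≤ i)
    omega
  · rintro ⟨h1, h2⟩
    exact ⟨fun i _ => h2 i, fun i j hij => h1 i j hij⟩

theorem blockWordSum_univ (k m : ℕ) :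
    blockWordSum q k Set.univ k m = hq q k (m + 1) := by
  classical
  rw [hq_eq_sum q le_rfl, blockWordSum]
  refine Finset.sum_congr (Finset.filter_congr fun u hu => ?_) fun _ _ => rfl
  rw [Fintype.mem_piFinset] at hu
  rw [admissible_zero_iff, BlockWord]
  refine and_congr (by simp) ⟨fun _ i => Finset.mem_range.1 (hu i), fun _ j hj => ?_⟩
  omega

/-- The descent positions of a word with a block of length `i` put in front. -/
def prependBlock (i : ℕ) (I : Set ℕ) : Set ℕ := {x | x + 1 < i ∨ (i ≤ x ∧ x - i ∈ I)}

theorem blockWord_append_iff {i k m : ℕ} (hk : k ≤ n) (I : Set ℕ) (v : Fin i → ℕ)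
    (u : Fin n → ℕ) :
    BlockWord (prependBlock i I) k m (Fin.append v u) ↔
      Admissible (fun _ => 0) m v ∧ BlockWord I k m u := by
  rw [admissible_zero_iff]
  constructor
  · rintro ⟨h1, h2⟩
    refine ⟨⟨fun a b hab => ?_, fun a => ?_⟩, fun a b hab ha => ?_, fun a ha => ?_⟩
    · have := h1 (Fin.castAdd n a) (Fin.castAdd n b) (by simpa using hab)
        (Or.inl (by rw [Fin.val_castAdd]; omega))
      simpa using this
    · have := h2 (Fin.castAdd n a) (by rw [Fin.val_castAdd]; omega)
      simpa using this
    · have := h1 (Fin.natAdd i a) (Fin.natAdd i b) (by simp only [Fin.val_natAdd]; omega)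
        (Or.inr (by simpa using ha))
      simpa using this
    · have := h2 (Fin.natAdd i a) (by rw [Fin.val_natAdd]; omega)
      simpa using this
  · rintro ⟨⟨h1, h2⟩, h3, h4⟩
    refine ⟨fun a b => ?_, fun a => ?_⟩
    · refine Fin.addCases (fun a => ?_) (fun a => ?_) a <;>
        refine Fin.addCases (fun b => ?_) (fun b => ?_) b <;>
        simp only [Fin.append_left, Fin.append_right, Fin.val_castAdd, Fin.val_natAdd,
          prependBlock, Set.mem_ofPred_eq] <;> intro hab hI
      · exact h1 a b hab
      · omega
      · omega
      · rcases hI with hI | ⟨-, hI⟩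
        · omega
        · rw [Nat.add_sub_cancel_left] at hI
          exact h3 a b (by omega) hI
    · refine Fin.addCases (fun a => ?_) (fun a => ?_) a <;>
        simp only [Fin.append_left, Fin.append_right, Fin.val_castAdd, Fin.val_natAdd] <;>
        intro ha
      · exact h2 a
      · exact h4 a (by omega)

/-- Concatenation of words. Position i - 1 is left out of `prependBlock`, so nothing is required
where the two words meet, and `k ≤ n` keeps the last k positions inside the second word. -/
theorem hq_mul_blockWordSum {i k m : ℕ} (hk : k ≤ n) (I : Set ℕ) :
    hq q i m * blockWordSum q n I k m = blockWordSum q (i + n) (prependBlock i I) k m := by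
  classical
  rw [hq_eq_sum q (Nat.le_succ m), blockWordSum, blockWordSum, Finset.sum_mul_sum,
    ← Finset.sum_product']
  refine Finset.sum_bij' (fun p _ => Fin.append p.1 p.2)
    (fun u _ => (fun a => u (Fin.castAdd n a), fun a => u (Fin.natAdd i a))) ?_ ?_ ?_ ?_ ?_
  · intro p hp
    simp only [Finset.mem_product, Finset.mem_filter, Fintype.mem_piFinset] at hp ⊢
    refine ⟨fun a => ?_, (blockWord_append_iff hk I _ _).2 ⟨hp.1.2, hp.2.2⟩⟩
    refine Fin.addCases (fun a => ?_) (fun a => ?_) a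
    · rw [Fin.append_left]; exact hp.1.1 a
    · rw [Fin.append_right]; exact hp.2.1 a
  · intro u hu
    simp only [Finset.mem_product, Finset.mem_filter, Fintype.mem_piFinset] at hu ⊢
    have h := hu.2
    rw [← Fin.append_castAdd_natAdd (f := u), blockWord_append_iff hk] at h
    exact ⟨⟨fun a => hu.1 _, h.1⟩, fun a => hu.1 _, h.2⟩
  · intro p _
    simp
  · intro u _
    exact Fin.append_castAdd_natAdd
  · intro p _
    rw [Fin.sum_univ_add, pow_add]
    simp

end BlockWords

/-! ### Symmetric unimodal polynomials with a prescribed center. -/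

noncomputable section SymmetricUnimodal

theorem coeffLE_refl (f : QP) : CoeffLE f f := fun m => by simp

theorem CoeffLE.trans {f g h : QP} (h1 : CoeffLE f g) (h2 : CoeffLE g h) : CoeffLE f h := by
  intro m
  have e1 := h1 m
  have e2 := h2 m
  rw [MvPolynomial.coeff_sub] at *
  linarith

theorem CoeffLE.add {f g f' g' : QP} (h1 : CoeffLE f g) (h2 : CoeffLE f' g') :
    CoeffLE (f + f') (g + g') := by
  intro m
  have e1 := h1 m
  have e2 := h2 m
  rw [MvPolynomial.coeff_sub] at *
  rw [MvPolynomial.coeff_add, MvPolynomial.coeff_add]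
  linarith

theorem CoeffLE.X_pow_mul {f g : QP} (h : CoeffLE f g) (i : Fin 2) (k : ℕ) :
    CoeffLE (MvPolynomial.X i ^ k * f) (MvPolynomial.X i ^ k * g) := by
  induction k with
  | zero => simpa using h
  | succ k ih =>
    intro m
    rw [pow_succ', mul_assoc, mul_assoc, ← mul_sub, MvPolynomial.coeff_X_mul']
    split_ifs
    · exact ih _
    · exact le_rfl

/-- The coefficients of a polynomial, extended by `0` to negative exponents. -/
def intCoeff (P : QP[X]) (a : ℤ) : QP := if 0 ≤ a then P.coeff a.toNat else 0

theorem intCoeff_natCast (P : QP[X]) (a : ℕ) : intCoeff P a = P.coeff a := by simp [intCoeff]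

theorem intCoeff_of_neg (P : QP[X]) {a : ℤ} (ha : a < 0) : intCoeff P a = 0 :=
  if_neg (not_le.2 ha)

theorem intCoeff_add (P Q : QP[X]) (a : ℤ) :
    intCoeff (P + Q) a = intCoeff P a + intCoeff Q a := by
  unfold intCoeff; split_ifs <;> simp

theorem intCoeff_C_mul (x : QP) (P : QP[X]) (a : ℤ) :
    intCoeff (C x * P) a = x * intCoeff P a := by
  unfold intCoeff; split_ifs <;> simp

theorem intCoeff_X_mul (P : QP[X]) (a : ℤ) : intCoeff (X * P) a = intCoeff P (a - 1) := by
  rcases lt_trichotomy a 0 with h | rfl | h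
  · rw [intCoeff_of_neg _ h, intCoeff_of_neg _ (by omega)]
  · simp [intCoeff]
  · obtain ⟨b, rfl⟩ : ∃ b : ℕ, a = (b + 1 : ℕ) := ⟨(a - 1).toNat, by omega⟩
    rw [intCoeff_natCast, coeff_X_mul, Nat.cast_add, Nat.cast_one, add_sub_cancel_right,
      intCoeff_natCast]

/-- The coefficient sequence of `P` is symmetric about `N / 2`, and grows towards the centre. -/
def SymmUnimodal (N : ℤ) (P : QP[X]) : Prop :=
  (∀ a, intCoeff P a = intCoeff P (N - a)) ∧
    ∀ a b, a ≤ b → a + b ≤ N → CoeffLE (intCoeff P a) (intCoeff P b)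

theorem symmUnimodal_of_step {N : ℤ} {P : QP[X]} (h1 : ∀ a, intCoeff P a = intCoeff P (N - a))
    (h2 : ∀ a, 2 * a + 1 ≤ N → CoeffLE (intCoeff P a) (intCoeff P (a + 1))) :
    SymmUnimodal N P := by
  have h3 : ∀ a b, a ≤ b → 2 * b ≤ N + 1 → CoeffLE (intCoeff P a) (intCoeff P b) := by
    intro a b hab
    induction b, hab using Int.leInduction with
    | base => exact fun _ => coeffLE_refl _
    | succ b _ ih => exact fun hb => (ih (by omega)).trans (h2 b (by omega))
  refine ⟨h1, fun a b hab hN => ?_⟩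
  by_cases hb : 2 * b ≤ N + 1
  · exact h3 a b hab hb
  · rw [h1 b]
    exact h3 a (N - b) (by omega) (by omega)

theorem symmUnimodal_zero (N : ℤ) : SymmUnimodal N 0 := by
  have h : ∀ a, intCoeff 0 a = 0 := fun a => by simp [intCoeff]
  exact ⟨fun a => by rw [h, h], fun a b _ _ => by rw [h, h]; exact coeffLE_refl _⟩

theorem SymmUnimodal.add {N : ℤ} {P Q : QP[X]} (hP : SymmUnimodal N P) (hQ : SymmUnimodal N Q) :
    SymmUnimodal N (P + Q) := by
  refine ⟨fun a => ?_, fun a b hab hN => ?_⟩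
  · rw [intCoeff_add, intCoeff_add, hP.1, hQ.1]
  · rw [intCoeff_add, intCoeff_add]
    exact (hP.2 a b hab hN).add (hQ.2 a b hab hN)

theorem symmUnimodal_sum {N : ℤ} {ι : Type*} (T : Finset ι) (P : ι → QP[X])
    (h : ∀ i ∈ T, SymmUnimodal N (P i)) : SymmUnimodal N (∑ i ∈ T, P i) :=
  Finset.sum_induction P (SymmUnimodal N) (fun _ _ => SymmUnimodal.add) (symmUnimodal_zero N) h

theorem SymmUnimodal.C_X_pow_mul {N : ℤ} {P : QP[X]} (hP : SymmUnimodal N P) (i : Fin 2)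
    (k : ℕ) : SymmUnimodal N (C (MvPolynomial.X i ^ k) * P) := by
  refine ⟨fun a => ?_, fun a b hab hN => ?_⟩
  · rw [intCoeff_C_mul, intCoeff_C_mul, hP.1]
  · rw [intCoeff_C_mul, intCoeff_C_mul]
    exact (hP.2 a b hab hN).X_pow_mul i k

theorem SymmUnimodal.X_mul {N : ℤ} {P : QP[X]} (hP : SymmUnimodal N P) :
    SymmUnimodal (N + 2) (X * P) := by
  refine ⟨fun a => ?_, fun a b hab hN => ?_⟩
  · rw [intCoeff_X_mul, intCoeff_X_mul, hP.1]
    congr 1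
    ring
  · rw [intCoeff_X_mul, intCoeff_X_mul]
    exact hP.2 _ _ (by omega) (by omega)

theorem intCoeff_geom_mul (P : QP[X]) (i : ℕ) (a : ℤ) :
    intCoeff ((∑ l ∈ Finset.range i, X ^ l) * P) a = ∑ l ∈ Finset.range i, intCoeff P (a - l) := by
  have h : ∀ l : ℕ, ∀ a : ℤ, intCoeff (X ^ l * P) a = intCoeff P (a - l) := by
    intro l
    induction l with
    | zero => simp
    | succ l ih =>
      intro a
      rw [pow_succ', mul_assoc, intCoeff_X_mul, ih]
      congr 1
      push_cast
      ring
  induction i with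
  | zero => simp [intCoeff]
  | succ i ih => rw [Finset.sum_range_succ, add_mul, intCoeff_add, ih, h, Finset.sum_range_succ]

/-- A coefficient of the product is a sum over a window of i consecutive coefficients of P. Moving
the window up by one gains a coefficient at least as close to N / 2 as the one it loses. -/
theorem SymmUnimodal.geom_mul {N : ℤ} {P : QP[X]} (hP : SymmUnimodal N P) (i : ℕ) :
    SymmUnimodal (N + i - 1) ((∑ l ∈ Finset.range i, X ^ l) * P) := by
  refine symmUnimodal_of_step (fun a => ?_) fun a ha => ?_
  · rw [intCoeff_geom_mul, intCoeff_geom_mul, ← Finset.sum_range_reflect]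
    refine Finset.sum_congr rfl fun l hl => ?_
    have := Finset.mem_range.1 hl
    rw [hP.1]
    congr 1
    omega
  · rw [intCoeff_geom_mul, intCoeff_geom_mul]
    cases i with
    | zero => exact coeffLE_refl _
    | succ i =>
      rw [Finset.sum_range_succ, Finset.sum_range_succ', add_comm _ (intCoeff P (a - i)),
        add_comm _ (intCoeff P (a + 1 - (0 : ℕ)))]
      have hs : ∑ l ∈ Finset.range i, intCoeff P (a + 1 - (l + 1 : ℕ)) =
          ∑ l ∈ Finset.range i, intCoeff P (a - l) :=
        Finset.sum_congr rfl fun l _ => by congr 1; push_cast; ring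
      rw [hs]
      push_cast at ha
      exact (hP.2 _ _ (by push_cast; omega) (by push_cast; omega)).add (coeffLE_refl _)

theorem symmUnimodal_one : SymmUnimodal 0 1 := by
  have h : ∀ a, intCoeff 1 a = if a = 0 then 1 else 0 := by
    intro a
    unfold intCoeff
    rcases lt_trichotomy a 0 with h | rfl | h
    · rw [if_neg (by omega), if_neg (by omega)]
    · simp
    · rw [if_pos h.le, if_neg (by omega), coeff_one, if_neg (by omega)]
  refine symmUnimodal_of_step (fun a => ?_) fun a ha => ?_
  · rw [h, h]; simp
  · rw [h, h, if_neg (by omega)]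
    split_ifs
    · intro m
      rw [sub_zero, MvPolynomial.coeff_one]
      split_ifs <;> norm_num
    · exact coeffLE_refl _

/-- Reflection in N / 2 preserves the support, so it exchanges the lowest and the highest exponent.
-/
theorem SymmUnimodal.natDegree_add {N : ℤ} {P : QP[X]} (hP : SymmUnimodal N P) (h0 : P ≠ 0) :
    (P.natDegree + P.natTrailingDegree : ℤ) = N := by
  have h1 : intCoeff P (N - P.natDegree) ≠ 0 := by
    rw [← hP.1, intCoeff_natCast]
    exact mt leadingCoeff_eq_zero.1 h0
  have h2 : intCoeff P (N - P.natTrailingDegree) ≠ 0 := by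
    rw [← hP.1, intCoeff_natCast]
    exact mt trailingCoeff_eq_zero.1 h0
  have e1 : P.natTrailingDegree ≤ N - P.natDegree := by
    rcases lt_or_ge (N - P.natDegree : ℤ) 0 with h | h
    · exact absurd (intCoeff_of_neg _ h) h1
    · rw [intCoeff, if_pos h] at h1
      have := natTrailingDegree_le_of_ne_zero h1
      omega
  have e2 : N - P.natTrailingDegree ≤ P.natDegree := by
    rcases lt_or_ge (N - P.natTrailingDegree : ℤ) 0 with h | h
    · exact absurd (intCoeff_of_neg _ h) h2
    · rw [intCoeff, if_pos h] at h2
      have := le_natDegree_of_ne_zero h2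
      omega
  omega

theorem SymmUnimodal.isTSymmetric {N : ℤ} {P : QP[X]} (hP : SymmUnimodal N P) (h0 : P ≠ 0) :
    IsTSymmetric P ((N : ℚ) / 2) := by
  have hN := hP.natDegree_add h0
  refine ⟨h0, ?_, fun i hi => ?_⟩
  · rw [← hN]; push_cast; rfl
  · have := natTrailingDegree_le_natDegree P
    rw [← intCoeff_natCast, hP.1, ← intCoeff_natCast]
    congr 1
    omega

theorem SymmUnimodal.isTUnimodal {N : ℤ} {P : QP[X]} (hP : SymmUnimodal N P) (h0 : P ≠ 0) :
    IsTUnimodal CoeffLE P := by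
  have hN := hP.natDegree_add h0
  refine ⟨fun i _ hi => ?_, ?_, fun i hi _ => ?_⟩
  · rw [← intCoeff_natCast, ← intCoeff_natCast]
    exact hP.2 _ _ (by omega) (by omega)
  · rw [← intCoeff_natCast, hP.1, ← intCoeff_natCast]
    congr 1
    omega
  · rw [← intCoeff_natCast, hP.1, ← intCoeff_natCast]
    exact hP.2 _ _ (by omega) (by omega)

end SymmetricUnimodal

/-! ### Expansion in the sequences m ↦ h_n(m+1-d). -/

noncomputable section Expansion

/-- The indeterminate `q` as a constant polynomial. -/
abbrev constQ : QP[X] := C (MvPolynomial.X 0)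

/-- Coefficients with respect to the sequences `m ↦ h_n(1, q, ..., q^(m-d))`, `d ≤ n`, are
unique. -/
theorem eq_of_sum_mul_hq_eq {R : Type*} [CommRing R] (q : R) {n : ℕ} {w w' : ℕ → R}
    (h : ∀ m, ∑ d ∈ Finset.range (n + 1), w d * hq q n (m + 1 - d) =
      ∑ d ∈ Finset.range (n + 1), w' d * hq q n (m + 1 - d)) {d : ℕ} (hd : d ≤ n) :
    w d = w' d := by
  induction d using Nat.strong_induction_on with
  | _ d ih =>
    -- At m = d the system is triangular: terms with e > d involve the empty alphabet and vanish,
    -- and the term e = d has h_n(1) = 1.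
    have hsum : ∀ v : ℕ → R, ∑ e ∈ Finset.range (n + 1), v e * hq q n (d + 1 - e) =
        ∑ e ∈ Finset.range d, v e * hq q n (d + 1 - e) + v d := by
      intro v
      have : ∑ e ∈ Finset.range (d + 1), v e * hq q n (d + 1 - e) =
          ∑ e ∈ Finset.range (n + 1), v e * hq q n (d + 1 - e) := by
        refine Finset.sum_subset (Finset.range_subset_range.2 (by omega)) fun e he he' => ?_
        rw [Finset.mem_range] at he he'
        rw [show d + 1 - e = 0 by omega, hq_zero_right q (by omega), mul_zero]
      rw [← this, Finset.sum_range_succ, Nat.add_sub_cancel_left, hq_one_right, mul_one]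
    have h1 := h d
    rw [hsum, hsum, Finset.sum_congr rfl fun e he => by
      rw [ih e (Finset.mem_range.1 he) (by have := Finset.mem_range.1 he; omega)]] at h1
    exact add_left_cancel h1

/-- The sequences spanned by the block word enumerators, with symmetric unimodal coefficients. -/
def blockCone (N : ℤ) (n k : ℕ) : AddSubmonoid (ℕ → QP[X]) :=
  AddSubmonoid.closure {f | ∃ (P : QP[X]) (I : Set ℕ), SymmUnimodal N P ∧
    f = fun m => P * blockWordSum constQ n I k m}

/-- Standardization gives each generator a coefficient of h_n(m+1-d) that is a sum of P multiplied
by powers of q. Such factors respect both symmetry and the coefficientwise order. -/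
theorem exists_expansion {N : ℤ} {n k : ℕ} {f : ℕ → QP[X]} (hf : f ∈ blockCone N n k) :
    ∃ w : ℕ → QP[X], (∀ d, SymmUnimodal N (w d)) ∧
      ∀ m, f m = ∑ d ∈ Finset.range (n + 1), w d * hq constQ n (m + 1 - d) := by
  classical
  induction hf using AddSubmonoid.closure_induction with
  | mem f hf =>
    obtain ⟨P, I, hP, rfl⟩ := hf
    refine ⟨fun d => ∑ π : Equiv.Perm (Fin n) with InverseIncreasing I π ∧
      ∑ i ∈ Finset.range n, blockShift k π i = d,
        C (MvPolynomial.X 0 ^ (∑ i ∈ Finset.range n, i * blockShift k π i)) * P,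
      fun d => symmUnimodal_sum _ _ fun π _ => hP.C_X_pow_mul _ _, fun m => ?_⟩
    beta_reduce
    rw [blockWordSum_eq, Finset.mul_sum, ← Finset.sum_fiberwise_of_maps_to
      (t := Finset.range (n + 1)) (g := fun π : Equiv.Perm (Fin n) =>
        ∑ i ∈ Finset.range n, blockShift k π i)
      (fun π _ => Finset.mem_range.2 (Nat.lt_succ_of_le (sum_blockShift_le k π)))]
    refine Finset.sum_congr rfl fun d _ => ?_
    rw [Finset.filter_filter, Finset.sum_mul]
    refine Finset.sum_congr rfl fun π hπ => ?_
    rw [(Finset.mem_filter.1 hπ).2.2, C_pow]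
    ring
  | zero => exact ⟨fun _ => 0, fun _ => symmUnimodal_zero N, fun m => by simp⟩
  | add f g _ _ ihf ihg =>
    obtain ⟨v, hv, hf⟩ := ihf
    obtain ⟨w, hw, hg⟩ := ihg
    refine ⟨fun d => v d + w d, fun d => (hv d).add (hw d), fun m => ?_⟩
    rw [Pi.add_apply, hf, hg, ← Finset.sum_add_distrib]
    exact Finset.sum_congr rfl fun d _ => by ring

theorem mul_hq_mem_blockCone {N N' : ℤ} {n k : ℕ} (hk : k ≤ n) (i : ℕ) (A : QP[X])
    (hA : ∀ P, SymmUnimodal N P → SymmUnimodal N' (A * P)) {f : ℕ → QP[X]}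
    (hf : f ∈ blockCone N n k) :
    (fun m => A * hq constQ i m * f m) ∈ blockCone N' (i + n) k := by
  induction hf using AddSubmonoid.closure_induction with
  | mem f hf =>
    obtain ⟨P, I, hP, rfl⟩ := hf
    refine AddSubmonoid.subset_closure ⟨A * P, prependBlock i I, hA P hP, funext fun m => ?_⟩
    rw [← hq_mul_blockWordSum constQ hk]
    ring
  | zero =>
    convert (blockCone N' (i + n) k).zero_mem using 1
    funext m
    simp
  | add f g _ _ ihf ihg =>
    convert (blockCone N' (i + n) k).add_mem ihf ihg using 1
    funext m
    simp only [Pi.add_apply]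
    ring

/-- Induction along the recursion for D: each term prepends a block of length i + 1 and multiplies
by t [i]_t, which moves the center by (i+1)/2. -/
theorem hq_mul_coeff_derSeries_mem (n k : ℕ) :
    (fun m => hq constQ k (m + 1) * PowerSeries.coeff n (derSeries constQ X m)) ∈
      blockCone n (n + k) k := by
  induction n using Nat.strong_induction_on with
  | _ n ih =>
    cases n with
    | zero =>
      refine AddSubmonoid.subset_closure ⟨1, Set.univ, symmUnimodal_one, funext fun m => ?_⟩
      rw [coeff_zero_derSeries, one_mul, mul_one]
      simp only [zero_add]
      rw [blockWordSum_univ]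
    | succ n =>
      have : (fun m => hq constQ k (m + 1) *
          PowerSeries.coeff (n + 1) (derSeries constQ X m)) = ∑ i ∈ Finset.range (n + 1),
          fun m => X * (∑ l ∈ Finset.range i, X ^ l) * hq constQ (i + 1) m *
            (hq constQ k (m + 1) * PowerSeries.coeff (n - i) (derSeries constQ X m)) := by
        funext m
        rw [Finset.sum_apply, coeff_succ_derSeries, Finset.mul_sum]
        exact Finset.sum_congr rfl fun i _ => by ring
      rw [this]
      refine AddSubmonoid.sum_mem _ fun i hi => ?_
      have hi' := Finset.mem_range.1 hi
      have h := mul_hq_mem_blockCone (N' := (n + 1 : ℕ)) (by omega) (i + 1)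
        (X * ∑ l ∈ Finset.range i, X ^ l) (fun P hP => ?_) (ih (n - i) (by omega))
      · rwa [show i + 1 + (n - i + k) = n + 1 + k by omega] at h
      · rw [mul_assoc]
        have := (hP.geom_mul i).X_mul
        rwa [show ((n - i : ℕ) : ℤ) + i - 1 + 2 = (n + 1 : ℕ) by omega] at this

/-- Here the factor is [i+1]_t with center i/2 and the remaining coefficient has center (n-i)/2, so
every term has center n/2. -/
theorem coeff_hqSeries_mul_derSeries_mem (n : ℕ) :
    (fun m => PowerSeries.coeff (n + 1) (hqSeries constQ 1 m * derSeries constQ X m)) ∈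
      blockCone n (n + 1) 0 := by
  have : (fun m => PowerSeries.coeff (n + 1) (hqSeries constQ 1 m * derSeries constQ X m)) =
      ∑ i ∈ Finset.range (n + 1), fun m => (∑ l ∈ Finset.range (i + 1), X ^ l) *
        hq constQ (i + 1) m *
          (hq constQ 0 (m + 1) * PowerSeries.coeff (n - i) (derSeries constQ X m)) := by
    funext m
    rw [Finset.sum_apply, coeff_hqSeries_mul_derSeries]
    exact Finset.sum_congr rfl fun i _ => by rw [hq_zero_left]; ring
  rw [this]
  refine AddSubmonoid.sum_mem _ fun i hi => ?_
  have hi' := Finset.mem_range.1 hi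
  have h := mul_hq_mem_blockCone (N' := n) (by omega) (i + 1)
    (∑ l ∈ Finset.range (i + 1), X ^ l) (fun P hP => ?_) (hq_mul_coeff_derSeries_mem (n - i) 0)
  · rwa [show i + 1 + (n - i + 0) = n + 1 by omega] at h
  · have := hP.geom_mul (i + 1)
    rwa [show ((n - i : ℕ) : ℤ) + (i + 1 : ℕ) - 1 = n by omega] at this

end Expansion

/-! ### Enumerators with given fixed points and descents. -/

noncomputable section ExcedancePolynomials

theorem X_ne_one_QP : (X : QP[X]) ≠ 1 := X_ne_C 1

/-- The generating function identity holds for every r in the infinite domain `QP[X]`, hence as an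
identity of polynomials in r, and the coefficient of r^k can be compared. -/
theorem sum_fix_eq {n k : ℕ} (hk : k ≤ n) (m : ℕ) :
    ∑ σ : Equiv.Perm (Fin n) with fixNumber σ = k, X ^ excNumber σ *
        (constQ ^ (majIndex σ - excNumber σ) * hq constQ n (m + 1 - desNumber σ)) =
      hq constQ k (m + 1) * PowerSeries.coeff (n - k) (derSeries constQ X m) := by
  have h : ∑ σ : Equiv.Perm (Fin n), C (X ^ excNumber σ *
        (constQ ^ (majIndex σ - excNumber σ) * hq constQ n (m + 1 - desNumber σ))) *
          (X : QP[X][X]) ^ fixNumber σ =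
      ∑ x ∈ Finset.HasAntidiagonal.antidiagonal n, C (hq constQ x.1 (m + 1) *
        PowerSeries.coeff x.2 (derSeries constQ X m)) * X ^ x.1 := by
    refine Polynomial.funext fun r => ?_
    have := sum_perm_eq_coeff (n := n) constQ X_ne_one_QP r m
    rw [PowerSeries.coeff_mul] at this
    simp only [eval_finsetSum, eval_mul, eval_C, eval_pow, eval_X]
    simp only [hqSeries, PowerSeries.coeff_mk] at this
    refine (Eq.trans ?_ this).trans ?_ <;> refine Finset.sum_congr rfl fun _ _ => by ring
  have h' := congrArg (fun P => coeff P k) h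
  simp only [finsetSum_coeff, coeff_C_mul, coeff_X_pow, mul_ite, mul_one, mul_zero] at h'
  rw [Finset.sum_filter]
  simp only [eq_comm (a := fixNumber _)]
  rw [h', Finset.sum_eq_single (k, n - k)]
  · simp
  · rintro ⟨i, j⟩ hij hne
    rw [if_neg]
    rintro rfl
    rw [Finset.HasAntidiagonal.mem_antidiagonal] at hij
    exact hne (Prod.ext rfl (by simp only at hij ⊢; omega))
  · intro h
    exact absurd (Finset.HasAntidiagonal.mem_antidiagonal.2 (by simp only; omega)) h

/-- The enumerator of `(maj - exc, exc)` over the permutations in `T`, with a factor `x σ`. -/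
def excPoly {n : ℕ} (T : Finset (Equiv.Perm (Fin n))) (x : Equiv.Perm (Fin n) → QP) : QP[X] :=
  ∑ σ ∈ T, C (MvPolynomial.X 0 ^ (majIndex σ - excNumber σ) * x σ) * X ^ excNumber σ

/-- If the enumerators of the permutations in `T`, weighted by `h_n(1, ..., q^(m-d))`, lie in the
cone, then so do the enumerators of those with a given value of `d`. -/
theorem symmUnimodal_excPoly {N : ℤ} {n k : ℕ} {T : Finset (Equiv.Perm (Fin n))}
    {d : Equiv.Perm (Fin n) → ℕ} (hd : ∀ σ ∈ T, d σ ≤ n) {f : ℕ → QP[X]}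
    (hf : f ∈ blockCone N n k)
    (h : ∀ m, ∑ σ ∈ T, X ^ excNumber σ *
      (constQ ^ (majIndex σ - excNumber σ) * hq constQ n (m + 1 - d σ)) = f m) (e : ℕ) :
    SymmUnimodal N (excPoly (T.filter fun σ => d σ = e) fun _ => 1) := by
  obtain ⟨w, hw, hfw⟩ := exists_expansion hf
  by_cases he : e ≤ n
  · have := eq_of_sum_mul_hq_eq (w := fun e => excPoly (T.filter fun σ => d σ = e) fun _ => 1)
      (w' := w) constQ (fun m => ?_) he
    · rw [this]
      exact hw e
    · rw [← hfw, ← h, ← Finset.sum_fiberwise_of_maps_to (t := Finset.range (n + 1)) (g := d)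
        (fun σ hσ => Finset.mem_range.2 (Nat.lt_succ_of_le (hd σ hσ)))]
      refine Finset.sum_congr rfl fun e _ => ?_
      rw [excPoly, Finset.sum_mul]
      refine Finset.sum_congr rfl fun σ hσ => ?_
      rw [(Finset.mem_filter.1 hσ).2, mul_one, C_pow]
      ring
  · rw [Finset.filter_false_of_mem fun σ hσ (h : d σ = e) => he (h ▸ hd σ hσ)]
    exact symmUnimodal_zero N

/-- The exponent c covers both uses in terms of p: c = 1 keeps the variable, c = 0 sets it to 1. -/
theorem excPoly_eq_sum {n : ℕ} (T : Finset (Equiv.Perm (Fin n))) {d : Equiv.Perm (Fin n) → ℕ}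
    (hd : ∀ σ ∈ T, d σ ≤ n) (i : Fin 2) (c : ℕ) :
    excPoly T (fun σ => MvPolynomial.X i ^ (c * d σ)) = ∑ e ∈ Finset.range (n + 1),
      C (MvPolynomial.X i ^ (c * e)) * excPoly (T.filter fun σ => d σ = e) fun _ => 1 := by
  rw [excPoly, ← Finset.sum_fiberwise_of_maps_to (t := Finset.range (n + 1)) (g := d)
    (fun σ hσ => Finset.mem_range.2 (Nat.lt_succ_of_le (hd σ hσ)))]
  refine Finset.sum_congr rfl fun e _ => ?_
  rw [excPoly, Finset.mul_sum]
  refine Finset.sum_congr rfl fun σ hσ => ?_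
  rw [(Finset.mem_filter.1 hσ).2, mul_one, C_mul]
  ring

theorem desNumber_le {n : ℕ} (σ : Equiv.Perm (Fin n)) : desNumber σ ≤ n :=
  (Finset.card_le_univ _).trans (Fintype.card_fin n).le

theorem symmUnimodal_excPoly_fix {n k : ℕ} (hk : k ≤ n) (c : ℕ) :
    SymmUnimodal ((n : ℤ) - k) (excPoly
      (Finset.univ.filter fun σ : Equiv.Perm (Fin n) => fixNumber σ = k)
      fun σ => MvPolynomial.X 1 ^ (c * desNumber σ)) := by
  rw [excPoly_eq_sum _ fun σ _ => desNumber_le σ]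
  refine symmUnimodal_sum _ _ fun e _ => SymmUnimodal.C_X_pow_mul ?_ _ _
  refine symmUnimodal_excPoly (k := k) (fun σ _ => desNumber_le σ) ?_ (sum_fix_eq hk) e
  have := hq_mul_coeff_derSeries_mem (n - k) k
  rw [Nat.sub_add_cancel hk, Nat.cast_sub hk] at this
  exact this

theorem shiftSeq_one_le {n : ℕ} (σ : Equiv.Perm (Fin n)) (i : ℕ) : shiftSeq 1 σ i ≤ 1 := by
  cases i <;> rw [shiftSeq]
  split_ifs <;> simp

/-- The pieces are indexed by the modified descent count of `shiftSeq 1`, not by des. This is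
harmless because p = 1 and all pieces share the center n/2. -/
theorem symmUnimodal_excPoly_univ (n : ℕ) :
    SymmUnimodal n (excPoly (Finset.univ : Finset (Equiv.Perm (Fin (n + 1)))) fun _ => 1) := by
  have hd : ∀ σ ∈ (Finset.univ : Finset (Equiv.Perm (Fin (n + 1)))),
      ∑ i ∈ Finset.range (n + 1), shiftSeq 1 σ i ≤ n + 1 := fun σ _ => by
    refine (Finset.sum_le_card_nsmul _ _ 1 fun i _ => shiftSeq_one_le σ i).trans ?_
    simp
  have h := excPoly_eq_sum Finset.univ hd 0 0
  simp only [zero_mul, pow_zero] at h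
  rw [h]
  refine symmUnimodal_sum _ _ fun e _ => ?_
  rw [C_1, one_mul]
  exact symmUnimodal_excPoly hd (coeff_hqSeries_mul_derSeries_mem n)
    (sum_perm_eq_coeff_shiftSeq_one constQ X_ne_one_QP) e

/-- Setting all variables to 1 counts the permutations in T. -/
theorem excPoly_ne_zero {n : ℕ} {T : Finset (Equiv.Perm (Fin n))} (hT : T.Nonempty)
    {x : Equiv.Perm (Fin n) → QP} (hx : ∀ σ, MvPolynomial.eval (fun _ => 1) (x σ) = 1) :
    excPoly T x ≠ 0 := by
  intro h
  have h1 := congrArg (fun P => MvPolynomial.eval (fun _ => (1 : ℚ)) (eval 1 P)) h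
  simp only [excPoly, eval_finsetSum, eval_mul, eval_C, eval_pow, eval_X, one_pow, mul_one,
    map_sum, map_mul, map_pow, MvPolynomial.eval_X, hx, Finset.sum_const, eval_zero,
    map_zero, nsmul_eq_mul, Nat.cast_eq_zero, Finset.card_eq_zero] at h1
  exact hT.ne_empty h1

/-- The identity if k = n, otherwise a single cycle of length n - k ≥ 2. -/
theorem exists_fixNumber_eq {n k : ℕ} (hk : k ≤ n) (hk' : k + 1 ≠ n) :
    ∃ σ : Equiv.Perm (Fin n), fixNumber σ = k := by
  have hcard : ∀ σ : Equiv.Perm (Fin n), fixNumber σ + σ.support.card = n := by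
    intro σ
    have := Finset.card_filter_add_card_filter_not (s := (Finset.univ : Finset (Fin n)))
      (fun i => σ i = i)
    rw [Finset.card_univ, Fintype.card_fin] at this
    exact this
  rcases hk.eq_or_lt with rfl | hlt
  · refine ⟨1, ?_⟩
    have := hcard 1
    simpa using this
  · obtain ⟨σ, hσ⟩ := (Equiv.Perm.exists_with_cycleType_iff (α := Fin n) (m := {n - k})).2
      ⟨by simp, by simp; omega⟩
    refine ⟨σ, ?_⟩
    have h1 := hcard σ
    rw [← Equiv.Perm.sum_cycleType, hσ, Multiset.sum_singleton] at h1
    omega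

theorem excNumber_le_majIndex {n : ℕ} (σ : Equiv.Perm (Fin n)) : excNumber σ ≤ majIndex σ := by
  rw [← (shift_sums σ).2]
  exact Nat.le_add_left _ _

theorem qVar_ne_zero : qVar ≠ 0 := by
  rw [qVar, Ne, map_eq_zero_iff _ (IsFractionRing.injective QP QPField)]
  exact MvPolynomial.X_ne_zero 0

theorem map_excPoly {n : ℕ} (T : Finset (Equiv.Perm (Fin n))) (x : Equiv.Perm (Fin n) → QP) :
    (excPoly T x).map (algebraMap QP QPField) = ∑ σ ∈ T, C qVar ^ majIndex σ *
      C (algebraMap QP QPField (x σ)) * (C qVar⁻¹ * X) ^ excNumber σ := by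
  rw [excPoly, Polynomial.map_sum]
  refine Finset.sum_congr rfl fun σ _ => ?_
  obtain ⟨a, ha⟩ := Nat.exists_eq_add_of_le (excNumber_le_majIndex σ)
  rw [Polynomial.map_mul, map_C, Polynomial.map_pow, map_X, map_mul, map_pow, ← qVar, ha,
    Nat.add_sub_cancel_left, pow_add, mul_pow, C_mul, C_pow]
  have h1 : (C qVar : QPField[X]) ^ excNumber σ * C qVar⁻¹ ^ excNumber σ = 1 := by
    rw [← mul_pow, ← C_mul, mul_inv_cancel₀ qVar_ne_zero, C_1, one_pow]
  linear_combination (-(C qVar ^ a * C (algebraMap QP QPField (x σ)) * X ^ excNumber σ)) * h1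

theorem representsOverQP_fix (n k : ℕ) : RepresentsOverQP (excPoly
      (Finset.univ.filter fun σ : Equiv.Perm (Fin n) => fixNumber σ = k)
      fun σ => MvPolynomial.X 1 ^ (1 * desNumber σ))
    (eulerianAFix n k (C qVar) (C pVar) (C qVar⁻¹ * X)) := by
  rw [RepresentsOverQP, map_excPoly, eulerianAFix]
  simp only [one_mul, map_pow]
  rfl

theorem representsOverQP_fix_one (n k : ℕ) : RepresentsOverQP (excPoly
      (Finset.univ.filter fun σ : Equiv.Perm (Fin n) => fixNumber σ = k)
      fun σ => MvPolynomial.X 1 ^ (0 * desNumber σ))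
    (eulerianAFix n k (C qVar) 1 (C qVar⁻¹ * X)) := by
  rw [RepresentsOverQP, map_excPoly, eulerianAFix]
  simp only [zero_mul, pow_zero, map_one, one_pow]

theorem representsOverQP_univ (n : ℕ) :
    RepresentsOverQP (excPoly (Finset.univ : Finset (Equiv.Perm (Fin n))) fun _ => 1)
      (eulerianA n (C qVar) 1 (C qVar⁻¹ * X)) := by
  rw [RepresentsOverQP, map_excPoly, eulerianA]
  simp only [map_one, one_pow]

theorem excPoly_fix_ne_zero {n k : ℕ} (hk : k ≤ n) (hk' : k + 1 ≠ n) (c : ℕ) :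
    excPoly (Finset.univ.filter fun σ : Equiv.Perm (Fin n) => fixNumber σ = k)
      (fun σ => MvPolynomial.X 1 ^ (c * desNumber σ)) ≠ 0 := by
  obtain ⟨σ, hσ⟩ := exists_fixNumber_eq hk hk'
  exact excPoly_ne_zero ⟨σ, Finset.mem_filter.2 ⟨Finset.mem_univ _, hσ⟩⟩ fun σ => by simp

end ExcedancePolynomials

/-! ### The four claims. -/

theorem mainTheorem8 :
    (∀ n k : ℕ, k ≤ n → k + 1 ≠ n →
      ∃ F : QP[X],
        RepresentsOverQP F (eulerianAFix n k (C qVar) (C pVar) (C qVar⁻¹ * X)) ∧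
        IsTSymmetric F (((n : ℚ) - (k : ℚ)) / 2)) ∧
    (∀ n : ℕ, n ≠ 1 →
      ∃ F : QP[X],
        RepresentsOverQP F (eulerianAFix n 0 (C qVar) (C pVar) (C qVar⁻¹ * X)) ∧
        IsTSymmetric F ((n : ℚ) / 2) ∧ IsTUnimodal CoeffLE F) ∧
    (∀ n k : ℕ, k ≤ n → k + 1 ≠ n →
      ∃ F : QP[X],
        RepresentsOverQP F (eulerianAFix n k (C qVar) 1 (C qVar⁻¹ * X)) ∧
        IsTSymmetric F (((n : ℚ) - (k : ℚ)) / 2) ∧ IsTUnimodal CoeffLE F) ∧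
    (∀ n : ℕ, 1 ≤ n →
      ∃ F : QP[X],
        RepresentsOverQP F (eulerianA n (C qVar) 1 (C qVar⁻¹ * X)) ∧
        IsTSymmetric F (((n : ℚ) - 1) / 2) ∧ IsTUnimodal CoeffLE F) := by
  have hsym : ∀ n k c : ℕ, k ≤ n → k + 1 ≠ n → IsTSymmetric (excPoly
      (Finset.univ.filter fun σ : Equiv.Perm (Fin n) => fixNumber σ = k)
      fun σ => MvPolynomial.X 1 ^ (c * desNumber σ)) (((n : ℚ) - (k : ℚ)) / 2) := by
    intro n k c hk hk'
    have := (symmUnimodal_excPoly_fix hk c).isTSymmetric (excPoly_fix_ne_zero hk hk' c)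
    push_cast at this
    exact this
  have huni : ∀ n k c : ℕ, k ≤ n → k + 1 ≠ n → IsTUnimodal CoeffLE (excPoly
      (Finset.univ.filter fun σ : Equiv.Perm (Fin n) => fixNumber σ = k)
      fun σ => MvPolynomial.X 1 ^ (c * desNumber σ)) := fun n k c hk hk' =>
    (symmUnimodal_excPoly_fix hk c).isTUnimodal (excPoly_fix_ne_zero hk hk' c)
  refine ⟨fun n k hk hk' => ⟨_, representsOverQP_fix n k, hsym n k 1 hk hk'⟩,
    fun n hn => ⟨_, representsOverQP_fix n 0, ?_, huni n 0 1 (Nat.zero_le n) (by omega)⟩,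
    fun n k hk hk' => ⟨_, representsOverQP_fix_one n k, hsym n k 0 hk hk', huni n k 0 hk hk'⟩,
    fun n hn => ⟨_, representsOverQP_univ n, ?_⟩⟩
  · have := hsym n 0 1 (Nat.zero_le n) (by omega)
    rwa [Nat.cast_zero, sub_zero] at this
  · obtain ⟨n, rfl⟩ : ∃ l, n = l + 1 := ⟨n - 1, by omega⟩
    have h0 : excPoly (Finset.univ : Finset (Equiv.Perm (Fin (n + 1)))) (fun _ => 1) ≠ 0 :=
      excPoly_ne_zero Finset.univ_nonempty fun _ => map_one _
    refine ⟨?_, (symmUnimodal_excPoly_univ n).isTUnimodal h0⟩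
    have := (symmUnimodal_excPoly_univ n).isTSymmetric h0
    push_cast at this ⊢
    rwa [add_sub_cancel_right]
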